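/- All graphs are finite, simple and undirected. A path in an edge-coloured (resp. vertex-coloured) graph is conflict-free if some colour is used on exactly one of its edges (resp. vertices). For a connected graph $G$, let $\mathrm{cfc}(G)$ (resp. $\mathrm{vcfc}(G)$) be the smallest number of colours in an edge-colouring (resp. vertex-colouring) of $G$ such that any two distinct vertices are joined by a conflict-free path. Let $C(G)$ be the subgraph of $G$ induced by the set of cut-edges of $G$ (its edges are the cut-edges, its vertices their ends), and let $h(G)=\max\{\mathrm{cfc}(T): T \text{ is a component of } C(G)\}$, with $h(G)=0$ if $G$ has no cut-edge. Let $F$ be the graph on nine vertices obtained from a triangle by attaching two pendant vertices to each of its three vertices. Call $G$ exceptional if it contains $F$ as an induced subgraph in such a way that the triangle of $F$ is a block of $G$ and the cut-edges of $G$ are exactly the six pendant edges of $F$; that is, $G$ is $F$, possibly with further blocks on at least three vertices. Theorem. Let $G$ be a connected graph of diameter $3$. Then $\mathrm{vcfc}(G)\le 3$. If $G$ is not exceptional, then $\mathrm{cfc}(G)=\max\{2,h(G)\}$. If $G$ is exceptional, then $\mathrm{cfc}(G)=h(G)+1=3$. -/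

import Mathlib

namespace ConflictFree

universe u

/-- A list of pairwise distinct items, coloured by `c`, is conflict-free if some colour
occurs on exactly one of its items. -/
def UniqueColor {α κ : Type*} (c : α → κ) (l : List α) : Prop :=
  ∃ x ∈ l, ∀ y ∈ l, c y = c x → y = x

/-- `c` is a conflict-free connection colouring of (the edges of) `G`: any two distinct
vertices are joined by a path some colour of which is used on exactly one of its edges.
Only the values of `c` on edges of `G` matter. -/
def IsCFConnectionColoring {V : Type u} (G : SimpleGraph V) {κ : Type*} (c : Sym2 V → κ) : Prop :=
  ∀ u v : V, u ≠ v → ∃ p : G.Walk u v, p.IsPath ∧ UniqueColor c p.edges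

/-- `c` is a conflict-free vertex-connection colouring of `G`: any two distinct vertices are
joined by a path some colour of which is used on exactly one of its vertices. -/
def IsCFVertexConnectionColoring {V : Type u} (G : SimpleGraph V) {κ : Type*} (c : V → κ) : Prop :=
  ∀ u v : V, u ≠ v → ∃ p : G.Walk u v, p.IsPath ∧ UniqueColor c p.support

/-- The conflict-free connection number (of a finite connected graph). -/
noncomputable def cfc {V : Type u} (G : SimpleGraph V) : ℕ :=
  sInf {k : ℕ | ∃ c : Sym2 V → Fin k, IsCFConnectionColoring G c}

/-- The conflict-free vertex-connection number (of a finite connected graph). -/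
noncomputable def vcfc {V : Type u} (G : SimpleGraph V) : ℕ :=
  sInf {k : ℕ | ∃ c : V → Fin k, IsCFVertexConnectionColoring G c}

/-- The set of cut-edges of `G`. -/
def cutEdges {V : Type u} (G : SimpleGraph V) : Set (Sym2 V) :=
  {e | e ∈ G.edgeSet ∧ G.IsBridge e}

/-- The subgraph `C(G)` of `G` induced by the set of cut-edges: its edges are the cut-edges,
its vertices are the ends of cut-edges. -/
def cutEdgeSubgraph {V : Type u} (G : SimpleGraph V) : G.Subgraph where
  verts := {v | ∃ e ∈ cutEdges G, v ∈ e}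
  Adj a b := s(a, b) ∈ cutEdges G
  adj_sub h := h.1
  edge_vert {a b} h := ⟨s(a, b), h, Sym2.mem_mk_left a b⟩
  symm := ⟨fun a b h => by rw [Sym2.eq_swap]; exact h⟩

/-- `h(G)`: the maximum of `cfc T` over the components `T` of `C(G)` (for finite `G`);
it is `0` if `G` has no cut-edge. -/
noncomputable def h {V : Type u} (G : SimpleGraph V) : ℕ :=
  ⨆ T : (cutEdgeSubgraph G).coe.ConnectedComponent, cfc T.toSimpleGraph

/-- A nonseparable graph: connected, and without cut-vertices. -/
def Nonseparable {V : Type u} (G : SimpleGraph V) : Prop :=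
  G.Connected ∧ ∀ v : V, (G.induce {v}ᶜ).Preconnected

/-- `S` is the vertex set of a block of `G` (a maximal nonseparable subgraph; blocks of a
simple graph are induced subgraphs). -/
def IsBlock {V : Type u} (G : SimpleGraph V) (S : Set V) : Prop :=
  Nonseparable (G.induce S) ∧ ∀ T : Set V, S ⊆ T → Nonseparable (G.induce T) → T = S

/-- The graph on nine vertices made of a triangle with vertices `(0,0), (1,0), (2,0)` and two
pendant vertices `(i,1), (i,2)` attached to each vertex `(i,0)` of it; thus each vertex of the
triangle is the middle vertex of a path `P₃` of pendant edges. -/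
def triangleWithStars : SimpleGraph (Fin 3 × Fin 3) where
  Adj p q := p ≠ q ∧ ((p.2 = 0 ∧ q.2 = 0) ∨ (p.1 = q.1 ∧ (p.2 = 0 ∨ q.2 = 0)))
  symm := ⟨by decide⟩
  loopless := ⟨by decide⟩

/-- `G` contains `triangleWithStars` as an induced subgraph in such a way that the triangle is a
block of `G` and the cut-edges of `G` are exactly the six star edges. So `G` is
`triangleWithStars` itself, up to further blocks with at least three vertices. -/
def IsExceptional {V : Type u} (G : SimpleGraph V) : Prop :=
  ∃ φ : triangleWithStars ↪g G,
    IsBlock G (Set.range fun i : Fin 3 => φ (i, 0)) ∧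
    cutEdges G = {e | ∃ i j : Fin 3, j ≠ 0 ∧ e = s(φ (i, 0), φ (i, j))}

end ConflictFree

section

open SimpleGraph ConflictFree

universe u
variable {V : Type u} {G : SimpleGraph V}

/-! Cut-edges are rigid: a cut-edge on one path from `u` to `v` lies on all of them, and a path of
cut-edges is the only path between its ends. So a conflict-free connection colouring is proper on
the cut-edges. Conversely, in diameter three a path of cut-edges has at most three edges, and
properness already makes it conflict-free. Hence, for positive `k`, `h G ≤ k` says exactly that `k`
colours allow a colouring proper on cut-edges (`h_le_of_properOnCuts`,
`exists_properOnCuts_of_h_le`). As vertices at distance three rule out a single colour, `max 2 (h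
G)` is a lower bound.

For the upper bound, such a colouring is extended to the other edges with one distinguished colour
`σ`. It suffices that every pair not joined by cut-edges has a path with no non-cut-edge coloured
`σ` and a path with exactly one; the sole remaining obstruction is a `CutQuadruple` whose two end
edges have colour `σ` (`isCFConnectionColoring_of_cutQuadruple`). Without quadruples, let `σ` be the
colour of the non-cut-edges outside a spanning tree: exchanging one tree edge turns the first path
into the second.

If a quadruple exists, the diameter forces all cut-edges to be pendant and their supporting vertices
to form a clique `A`. The tree is chosen to contain a star spanning `A`, and a few edges inside `A`
may receive `σ`. This works if some edge outside `A` joins two branches, if some vertex of `A`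
misses a colour on its pendant edges, if `A` has at least four vertices, or if a third colour is
available. What is left is a triangle with two pendant edges at each vertex, i.e. an exceptional
graph with two colours. There two colours fail, because any two of the three triangle edges would
need different colours.

For vertices, a cut-vertex `c`, if there is one, gets a colour of its own, the other cut-vertices a
second colour and the remaining vertices a third. Either some path between the given vertices passes
through `c`, or a cut-vertex `z` separates both from `c`, and the diameter makes each of them equal
or adjacent to `z`. -/

/-- An edge colouring that is proper on the cut-edges. -/
def ProperOnCuts (G : SimpleGraph V) {κ : Type*} (c : Sym2 V → κ) : Prop :=
  ∀ a b b', s(a, b) ∈ cutEdges G → s(a, b') ∈ cutEdges G → b ≠ b' → c s(a, b) ≠ c s(a, b')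

/-! ### Cut-edges and paths -/

lemma mem_edges_of_mem_cutEdges {a b : V} (h : s(a, b) ∈ cutEdges G) (p : G.Walk a b) :
    s(a, b) ∈ p.edges :=
  isBridge_iff_forall_walk_mem_edges.1 h.2 p

/-- If the two paths had different first edges, following `q` from its second vertex and returning
along `p` would bypass the first edge of `q`, which is a cut-edge. -/
lemma bridge_path_unique {u v : V} {q : G.Walk u v} (hq : q.IsPath)
    (hb : ∀ e ∈ q.edges, e ∈ cutEdges G) {p : G.Walk u v} (hp : p.IsPath) : p = q := by
  induction q with
  | nil => exact Walk.eq_nil_iff_nil.2 (Walk.isPath_iff_nil.1 hp)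
  | @cons u w v h q ih =>
    cases p with
    | nil => simp at hq
    | @cons _ w' _ h' p =>
      rw [Walk.cons_isPath_iff] at hq hp
      by_cases hw : w' = w
      · subst hw
        rw [ih hq.1 (fun e he => hb e (by simp [he])) hp.1]
      · exfalso
        have hm := mem_edges_of_mem_cutEdges (a := w) (b := u)
          (by rw [Sym2.eq_swap]; exact hb _ (by simp)) ((q.append p.reverse).concat h'.symm)
        simp only [Walk.edges_concat, Walk.edges_append, Walk.edges_reverse, List.concat_eq_append,
          List.mem_append, List.mem_reverse, List.mem_singleton] at hm
        rcases hm with (hm | hm) | hm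
        · exact hq.2 (Walk.snd_mem_support_of_mem_edges _ hm)
        · exact hp.2 (Walk.snd_mem_support_of_mem_edges _ hm)
        · rw [Sym2.eq_iff] at hm
          rcases hm with ⟨hm, -⟩ | ⟨hm, -⟩
          · exact hw hm.symm
          · exact h.ne hm.symm

lemma cutEdge_mem_edges {u v : V} {p : G.Walk u v} (hp : p.IsPath) {e : Sym2 V}
    (he : e ∈ cutEdges G) (hep : e ∈ p.edges) (q : G.Walk u v) : e ∈ q.edges := by
  induction p with
  | nil => simp at hep
  | @cons u w v h p ih =>
    rw [Walk.cons_isPath_iff] at hp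
    rw [Walk.edges_cons, List.mem_cons] at hep
    rcases hep with rfl | hep
    · have hm := mem_edges_of_mem_cutEdges he (q.append p.reverse)
      simp only [Walk.edges_append, Walk.edges_reverse, List.mem_append, List.mem_reverse] at hm
      exact hm.resolve_right fun hm => hp.2 (Walk.fst_mem_support_of_mem_edges _ hm)
    · have hm := ih hp.1 hep (Walk.cons h.symm q)
      rw [Walk.edges_cons, List.mem_cons] at hm
      refine hm.resolve_left ?_
      rintro rfl
      exact hp.2 (Walk.snd_mem_support_of_mem_edges _ hep)

/-- If `u` and `v` are separated in `L` and an edge `s(x, y)` of `G` reconnects them, there is a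
`u`-`v` path using that edge and otherwise only edges of `L`. -/
lemma exists_path_through_edge {L : SimpleGraph V} (hL : L ≤ G) {u v x y : V} (hxy : G.Adj x y)
    (hux : L.Reachable u x) (hyv : L.Reachable y v) (huv : ¬ L.Reachable u v) :
    ∃ p : G.Walk u v, p.IsPath ∧ s(x, y) ∈ p.edges ∧ ∀ e ∈ p.edges, e ≠ s(x, y) →
      e ∈ L.edgeSet := by
  classical
  have hle : L ⊔ edge x y ≤ G := sup_le hL (by
    rw [edge_le_iff]; exact Or.inr hxy)
  have hr : (L ⊔ edge x y).Reachable u v := by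
    refine (hux.mono le_sup_left).trans ((Adj.reachable ?_).trans (hyv.mono le_sup_left))
    simp [edge_adj, hxy.ne]
  obtain ⟨p, hp⟩ := hr.exists_isPath
  have hE : ∀ e ∈ p.edges, e ≠ s(x, y) → e ∈ L.edgeSet := by
    intro e he hne
    have := p.edges_subset_edgeSet he
    induction e with
    | h a b =>
      rw [mem_edgeSet, sup_adj, edge_adj] at this
      rcases this with h | ⟨⟨rfl, rfl⟩ | ⟨rfl, rfl⟩, -⟩
      · exact h
      · exact absurd rfl hne
      · exact absurd Sym2.eq_swap hne
  refine ⟨p.mapLe hle, hp.mapLe hle, ?_, ?_⟩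
  · rw [Walk.edges_mapLe_eq_edges]
    by_contra hn
    exact huv ⟨p.transfer L fun e he => hE e he (by rintro rfl; exact hn he)⟩
  · rw [Walk.edges_mapLe_eq_edges]
    exact hE

lemma exists_short_path [Finite V] (hconn : G.Connected) (hdiam : G.diam = 3) (u v : V) :
    ∃ p : G.Walk u v, p.IsPath ∧ p.length ≤ 3 := by
  have := hconn.nonempty
  obtain ⟨p, hp, hl⟩ := hconn.exists_path_of_dist u v
  refine ⟨p, hp, hl ▸ hdiam ▸ dist_le_diam ?_⟩
  exact connected_iff_ediam_ne_top.1 hconn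

/-- A path of cut-edges is conflict-free under a colouring that is proper on cut-edges, in a
graph of diameter three. -/
lemma uniqueColor_of_cut_path [Finite V] (hconn : G.Connected) (hdiam : G.diam = 3) {κ : Type*}
    {c : Sym2 V → κ} (hc : ProperOnCuts G c) {u v : V} (huv : u ≠ v) {p : G.Walk u v}
    (hp : p.IsPath) (hb : ∀ e ∈ p.edges, e ∈ cutEdges G) : UniqueColor c p.edges := by
  obtain ⟨q, hq, hl⟩ := exists_short_path hconn hdiam u v
  obtain rfl := bridge_path_unique hp hb hq
  have hc' : ∀ a b b', s(a, b) ∈ cutEdges G → s(b, b') ∈ cutEdges G → a ≠ b' →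
      c s(a, b) ≠ c s(b, b') := by
    intro a b b' h1 h2 hne
    rw [Sym2.eq_swap (a := a)] at h1 ⊢
    exact hc b a b' h1 h2 hne
  cases q with
  | nil => exact absurd rfl huv
  | cons h1 q =>
  cases q with
  | nil => simp [UniqueColor]
  | cons h2 q =>
  cases q with
  | nil =>
    simp only [Walk.edges_cons, Walk.edges_nil, List.mem_cons, List.not_mem_nil, or_false,
      forall_eq_or_imp, forall_eq] at hb
    have := hc' _ _ _ hb.1 hb.2 huv
    refine ⟨_, List.mem_cons_self, ?_⟩
    simpa using fun h => absurd h.symm this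
  | cons h3 q =>
  cases q with
  | cons h4 q => simp at hl; omega
  | nil =>
    simp only [Walk.edges_cons, Walk.edges_nil, List.mem_cons, List.not_mem_nil, or_false,
      forall_eq_or_imp, forall_eq] at hb
    simp only [Walk.cons_isPath_iff, Walk.support_cons, Walk.support_nil, List.mem_cons] at hp
    have e1 := hc' _ _ _ hb.1 hb.2.1 (by rintro rfl; simp at hp)
    have e2 := hc' _ _ _ hb.2.1 hb.2.2 (by rintro rfl; simp at hp)
    refine ⟨_, List.mem_cons_of_mem _ List.mem_cons_self, ?_⟩
    intro y hy hyc
    simp only [Walk.edges_cons, Walk.edges_nil, List.mem_cons, List.not_mem_nil, or_false] at hy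
    rcases hy with rfl | rfl | rfl
    · exact absurd hyc e1
    · rfl
    · exact absurd hyc.symm e2

/-! ### Bounds for `cfc`, and `h` as a bound on colourings proper on cut-edges -/

lemma ConflictFree.UniqueColor.of_map {α β κ : Type*} {c : β → κ} {g : α → β} (hg : Function.Injective g)
    {l : List α} (h : UniqueColor c (l.map g)) : UniqueColor (fun x => c (g x)) l := by
  obtain ⟨x, hx, hu⟩ := h
  obtain ⟨x, hx', rfl⟩ := List.mem_map.1 hx
  exact ⟨x, hx', fun y hy hyx => hg (hu _ (List.mem_map_of_mem hy) hyx)⟩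

lemma ConflictFree.UniqueColor.comp_injective {α κ κ' : Type*} {c : α → κ} {g : κ → κ'}
    (hg : Function.Injective g) {l : List α} (h : UniqueColor c l) :
    UniqueColor (fun x => g (c x)) l := by
  obtain ⟨x, hx, hu⟩ := h
  exact ⟨x, hx, fun y hy hyx => hu y hy (hg hyx)⟩

lemma exists_cfColoring_card [Finite V] (hG : G.Connected) :
    ∃ c : Sym2 V → Fin (Nat.card (Sym2 V)), IsCFConnectionColoring G c := by
  refine ⟨Finite.equivFin _, fun u v huv => ?_⟩
  obtain ⟨p, hp⟩ := hG.exists_isPath u v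
  refine ⟨p, hp, ?_⟩
  cases p with
  | nil => exact absurd rfl huv
  | cons h p =>
    exact ⟨_, List.mem_cons_self, fun y _ hy => (Finite.equivFin _).injective hy⟩

lemma cfc_spec [Finite V] (hG : G.Connected) :
    ∃ c : Sym2 V → Fin (cfc G), IsCFConnectionColoring G c :=
  Nat.sInf_mem (s := {k | ∃ c : Sym2 V → Fin k, IsCFConnectionColoring G c})
    ⟨_, exists_cfColoring_card hG⟩

lemma cfc_le {k : ℕ} {c : Sym2 V → Fin k} (hc : IsCFConnectionColoring G c) : cfc G ≤ k :=
  Nat.sInf_le ⟨c, hc⟩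

lemma exists_cfColoring_of_cfc_le [Finite V] (hG : G.Connected) {k : ℕ} (hk : cfc G ≤ k) :
    ∃ c : Sym2 V → Fin k, IsCFConnectionColoring G c := by
  obtain ⟨c, hc⟩ := cfc_spec hG
  refine ⟨fun e => Fin.castLE hk (c e), fun u v huv => ?_⟩
  obtain ⟨p, hp, hu⟩ := hc u v huv
  exact ⟨p, hp, hu.comp_injective (Fin.castLE_injective hk)⟩

/-- A path between two vertices whose ends are joined to a common vertex by cut-edges consists of
these two cut-edges. -/
lemma edges_eq_of_cutEdges {a b b' : V} (h : s(a, b) ∈ cutEdges G) (h' : s(a, b') ∈ cutEdges G)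
    (hne : b ≠ b') {p : G.Walk b b'} (hp : p.IsPath) : p.edges = [s(b, a), s(a, b')] := by
  have hq : (Walk.cons (G.mem_edgeSet.1 h.1).symm (Walk.cons (G.mem_edgeSet.1 h'.1) Walk.nil) :
      G.Walk b b').IsPath := by
    simp [Walk.cons_isPath_iff, (G.mem_edgeSet.1 h.1).ne', (G.mem_edgeSet.1 h'.1).ne, hne]
  rw [bridge_path_unique hq _ hp]
  · simp
  · simp only [Walk.edges_cons, Walk.edges_nil, List.mem_cons, List.not_mem_nil, or_false,
      forall_eq_or_imp, forall_eq]
    exact ⟨by rwa [Sym2.eq_swap], h'⟩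

lemma ne_of_uniqueColor_pair {α κ : Type*} {c : α → κ} {x y : α} (hxy : x ≠ y)
    (h : UniqueColor c [x, y]) : c x ≠ c y := by
  obtain ⟨z, hz, hu⟩ := h
  intro hc
  simp only [List.mem_cons, List.not_mem_nil, or_false] at hz hu
  rcases hz with rfl | rfl
  · exact hxy (hu y (Or.inr rfl) hc.symm).symm
  · exact hxy (hu x (Or.inl rfl) hc)

/-- The only path from `b` to `b'` consists of the two cut-edges at `a`, so a colour occurring once
on it forces these edges to differ in colour. -/
lemma properOnCuts_of_isCFConnectionColoring {κ : Type*} {c : Sym2 V → κ}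
    (hc : IsCFConnectionColoring G c) : ProperOnCuts G c := by
  intro a b b' h h' hne
  obtain ⟨p, hp, hu⟩ := hc b b' hne
  rw [edges_eq_of_cutEdges h h' hne hp, Sym2.eq_swap] at hu
  exact ne_of_uniqueColor_pair (fun h => hne (Sym2.congr_right.1 h)) hu

/-- The inclusion of a component of `C(G)` into `G`. -/
def cutComponentHom (T : (cutEdgeSubgraph G).coe.ConnectedComponent) : T.toSimpleGraph →g G :=
  (cutEdgeSubgraph G).hom.comp T.toSimpleGraph_hom

lemma cutComponentHom_injective (T : (cutEdgeSubgraph G).coe.ConnectedComponent) :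
    Function.Injective (cutComponentHom T) := fun _ _ h => Subtype.ext (Subtype.ext h)

lemma cutComponentHom_edges (T : (cutEdgeSubgraph G).coe.ConnectedComponent) {u v : T}
    (p : T.toSimpleGraph.Walk u v) : ∀ e ∈ (p.map (cutComponentHom T)).edges, e ∈ cutEdges G := by
  intro e he
  rw [Walk.edges_map, List.mem_map] at he
  obtain ⟨e, he, rfl⟩ := he
  have := p.edges_subset_edgeSet he
  induction e with
  | h a b => exact this

lemma h_le_of_properOnCuts [Finite V] (hconn : G.Connected) (hdiam : G.diam = 3) {k : ℕ}
    {c : Sym2 V → Fin k} (hc : ProperOnCuts G c) : h G ≤ k := by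
  refine ciSup_le' fun T => cfc_le (c := fun e => c (e.map (cutComponentHom T))) ?_
  intro u v huv
  obtain ⟨p, hp⟩ := T.connected_toSimpleGraph.exists_isPath u v
  refine ⟨p, hp, UniqueColor.of_map (Sym2.map.injective (cutComponentHom_injective T)) ?_⟩
  rw [← Walk.edges_map]
  exact uniqueColor_of_cut_path hconn hdiam hc
    (fun h => huv (cutComponentHom_injective T h))
    (hp.map (cutComponentHom_injective T)) (cutComponentHom_edges T p)

/-- Conflict-free colourings of the components of `C(G)` are glued; they are proper because two
edges at a common vertex form the only path between their other ends. Edges outside `C(G)` get the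
default colour `0`, whence `0 < k`. -/
lemma exists_properOnCuts_of_h_le [Finite V] {k : ℕ} (hk : h G ≤ k) (hk0 : 0 < k) :
    ∃ c : Sym2 V → Fin k, ProperOnCuts G c := by
  have hT : ∀ T : (cutEdgeSubgraph G).coe.ConnectedComponent,
      ∃ c : Sym2 T → Fin k, IsCFConnectionColoring T.toSimpleGraph c := fun T =>
    exists_cfColoring_of_cfc_le T.connected_toSimpleGraph
      (le_trans (le_ciSup (f := fun T : (cutEdgeSubgraph G).coe.ConnectedComponent =>
        cfc T.toSimpleGraph) (Set.finite_range _).bddAbove T) hk)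
  choose cT hcT using hT
  let F : (Σ T : (cutEdgeSubgraph G).coe.ConnectedComponent, Sym2 T) → Sym2 V :=
    fun x => x.2.map (cutComponentHom x.1)
  -- Components are disjoint, so an end of the edge determines the component.
  have hF : Function.Injective F := by
    rintro ⟨T, e⟩ ⟨T', e'⟩ h
    have hTT : T = T' := by
      induction e with
      | h a b =>
      have ha : cutComponentHom T a ∈ F ⟨T', e'⟩ := by
        rw [← h]; simp [F]
      obtain ⟨a', -, ha'⟩ := Sym2.mem_map.1 ha
      have h1 : a'.1 = a.1 := Subtype.ext ha'
      exact a.2.symm.trans (h1 ▸ a'.2)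
    subst hTT
    have := Sym2.map.injective (cutComponentHom_injective T) h
    exact congrArg _ this
  refine ⟨Function.extend F (fun x => cT x.1 x.2) fun _ => ⟨0, hk0⟩, ?_⟩
  intro a b b' h h' hne
  let a1 : (cutEdgeSubgraph G).verts := ⟨a, _, h, Sym2.mem_mk_left _ _⟩
  let b1 : (cutEdgeSubgraph G).verts := ⟨b, _, h, Sym2.mem_mk_right _ _⟩
  let b1' : (cutEdgeSubgraph G).verts := ⟨b', _, h', Sym2.mem_mk_right _ _⟩
  have hab : (cutEdgeSubgraph G).coe.Adj a1 b1 := h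
  have hab' : (cutEdgeSubgraph G).coe.Adj a1 b1' := h'
  let T := (cutEdgeSubgraph G).coe.connectedComponentMk a1
  let a2 : T := ⟨a1, rfl⟩
  let b2 : T := ⟨b1, ConnectedComponent.sound hab.reachable.symm⟩
  let b2' : T := ⟨b1', ConnectedComponent.sound hab'.reachable.symm⟩
  have hb2 : b2 ≠ b2' := fun h => hne (congrArg (fun x : T => x.1.1) h)
  have e1 : F ⟨T, s(a2, b2)⟩ = s(a, b) := rfl
  have e2 : F ⟨T, s(a2, b2')⟩ = s(a, b') := rfl
  rw [← e1, ← e2, hF.extend_apply, hF.extend_apply]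
  obtain ⟨p, hp, hu⟩ := hcT T b2 b2' hb2
  have hE := edges_eq_of_cutEdges h h' hne
    (p := p.map (cutComponentHom T))
    (hp.map (cutComponentHom_injective T))
  have hpe : p.edges = [s(b2, a2), s(a2, b2')] := by
    apply List.map_injective_iff.2 (Sym2.map.injective (cutComponentHom_injective T))
    rw [← Walk.edges_map]
    exact hE
  rw [hpe, Sym2.eq_swap] at hu
  exact ne_of_uniqueColor_pair (fun h => hb2 (Sym2.congr_right.1 h)) hu

lemma h_le_cfc [Finite V] (hconn : G.Connected) (hdiam : G.diam = 3) : h G ≤ cfc G := by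
  obtain ⟨c, hc⟩ := cfc_spec hconn
  exact h_le_of_properOnCuts hconn hdiam (properOnCuts_of_isCFConnectionColoring hc)

lemma two_le_cfc [Finite V] (hconn : G.Connected) (hdiam : G.diam = 3) : 2 ≤ cfc G := by
  have := hconn.nonempty
  obtain ⟨c, hc⟩ := cfc_spec hconn
  by_contra! hlt
  obtain ⟨u, v, huv⟩ := G.exists_dist_eq_diam
  rw [hdiam] at huv
  obtain ⟨p, hp, x, hx, hu⟩ := hc u v (by rintro rfl; simp at huv)
  -- With at most one colour every edge of the path equals `x`, yet the path has at least three
  -- distinct edges.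
  have hl : 3 ≤ p.edges.length := by rw [Walk.length_edges, ← huv]; exact dist_le p
  have hall : ∀ y ∈ p.edges, y = x := fun y hy => hu y hy (Fin.ext (by omega))
  have hnd := hp.isTrail.edges_nodup
  rw [List.eq_replicate_iff.2 ⟨rfl, hall⟩, List.nodup_replicate] at hnd
  omega

/-! ### A criterion with one distinguished colour -/

/-- `u, a, b, v` are the consecutive vertices of a path whose end edges are cut-edges and whose
middle edge is not. -/
structure CutQuadruple (G : SimpleGraph V) (u a b v : V) : Prop where
  left : s(u, a) ∈ cutEdges G
  right : s(b, v) ∈ cutEdges G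
  adj : G.Adj a b
  not_cut : s(a, b) ∉ cutEdges G
  ne : u ≠ v

/-- The path with one non-cut-edge coloured `σ` fails only if it contains a cut-edge `e` coloured
`σ`. Then `e` lies on the other path too, which fails only if it has a second such cut-edge. Both
lie on every path, in particular on one of length at most three; by properness they are its first
and third edges, and this is a quadruple. -/
lemma isCFConnectionColoring_of_cutQuadruple [Finite V] (hconn : G.Connected) (hdiam : G.diam = 3)
    {κ : Type*} {c : Sym2 V → κ} {σ : κ} (hc : ProperOnCuts G c)
    (hp : ∀ u v, u ≠ v → (¬ ∃ p : G.Walk u v, p.IsPath ∧ ∀ e ∈ p.edges, e ∈ cutEdges G) →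
      (∃ p : G.Walk u v, p.IsPath ∧ ∀ e ∈ p.edges, e ∉ cutEdges G → c e ≠ σ) ∧
      (∃ p : G.Walk u v, p.IsPath ∧ ∃ f ∈ p.edges, f ∉ cutEdges G ∧ c f = σ ∧
        ∀ e ∈ p.edges, e ∉ cutEdges G → c e = σ → e = f))
    (hq : ∀ u a b v, CutQuadruple G u a b v → c s(u, a) = σ → c s(b, v) = σ →
      ∃ p : G.Walk u v, p.IsPath ∧ UniqueColor c p.edges) :
    IsCFConnectionColoring G c := by
  intro u v huv
  by_cases hcut : ∃ p : G.Walk u v, p.IsPath ∧ ∀ e ∈ p.edges, e ∈ cutEdges G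
  · obtain ⟨p, hp, hb⟩ := hcut
    exact ⟨p, hp, uniqueColor_of_cut_path hconn hdiam hc huv hp hb⟩
  obtain ⟨⟨p₀, hp₀, h₀⟩, p₁, hp₁, f, hf, hfc, hfσ, h₁⟩ := hp u v huv hcut
  by_cases hσ : ∃ e ∈ p₁.edges, e ∈ cutEdges G ∧ c e = σ
  swap
  · refine ⟨p₁, hp₁, f, hf, fun y hy hyf => h₁ y hy (fun hyc => hσ ⟨y, hy, hyc, ?_⟩) ?_⟩ <;>
    exact hyf.trans hfσ
  obtain ⟨e, he, hec, heσ⟩ := hσ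
  by_cases hσ' : ∃ e' ∈ p₀.edges, c e' = σ ∧ e' ≠ e
  swap
  · refine ⟨p₀, hp₀, e, cutEdge_mem_edges hp₁ hec he p₀, fun y hy hye => ?_⟩
    by_contra hne
    exact hσ' ⟨y, hy, hye.trans heσ, hne⟩
  obtain ⟨e', he', heσ', hne⟩ := hσ'
  have hec' : e' ∈ cutEdges G := by
    by_contra h
    exact h₀ e' he' h heσ'
  obtain ⟨q, hqp, hl⟩ := exists_short_path hconn hdiam u v
  have hq1 := cutEdge_mem_edges hp₁ hec he q
  have hq2 := cutEdge_mem_edges hp₀ hec' he' q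
  have hadj : ∀ a b b', s(a, b) ∈ cutEdges G → s(b, b') ∈ cutEdges G → a ≠ b' →
      c s(a, b) = σ → c s(b, b') = σ → False := by
    intro a b b' h1 h2 hne e1 e2
    rw [Sym2.eq_swap (a := a)] at h1 e1
    exact hc b a b' h1 h2 hne (e1.trans e2.symm)
  cases q with
  | nil => exact absurd rfl huv
  | cons g1 q =>
  cases q with
  | nil =>
    simp only [Walk.edges_cons, Walk.edges_nil, List.mem_singleton] at hq1 hq2
    exact absurd (hq2.trans hq1.symm) hne
  | cons g2 q =>
  cases q with
  | nil =>
    refine absurd ⟨_, hqp, ?_⟩ hcut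
    simp only [Walk.edges_cons, Walk.edges_nil, List.mem_cons, List.not_mem_nil, or_false] at *
    rintro x (rfl | rfl)
    · rcases hq1 with rfl | rfl
      · assumption
      · rcases hq2 with rfl | rfl
        · assumption
        · exact absurd rfl hne
    · rcases hq1 with rfl | rfl
      · rcases hq2 with rfl | rfl
        · exact absurd rfl hne
        · assumption
      · assumption
  | cons g3 q =>
  cases q with
  | cons h4 q => simp at hl; omega
  | @nil _ =>
    rename_i x y
    simp only [Walk.edges_cons, Walk.edges_nil, List.mem_cons, List.not_mem_nil, or_false]
      at hq1 hq2 hcut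
    have hd := hqp
    simp only [Walk.cons_isPath_iff, Walk.support_cons, Walk.support_nil, List.mem_cons,
      List.not_mem_nil, or_false, not_or] at hd
    obtain ⟨⟨-, hxy, hxv⟩, hux, huy, -⟩ := hd
    have key : s(u, x) ∈ cutEdges G → s(y, v) ∈ cutEdges G → c s(u, x) = σ → c s(y, v) = σ →
        ∃ p : G.Walk u v, p.IsPath ∧ UniqueColor c p.edges := by
      intro k1 k2 k3 k4
      refine hq u x y v ⟨k1, k2, g2, fun hxy => hcut ⟨_, hqp, ?_⟩, huv⟩ k3 k4
      simp only [Walk.edges_cons, Walk.edges_nil, List.mem_cons, List.not_mem_nil, or_false]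
      rintro z (rfl | rfl | rfl) <;> assumption
    rcases hq1 with rfl | rfl | rfl <;> rcases hq2 with rfl | rfl | rfl
    · exact absurd rfl hne
    · exact (hadj _ _ _ hec hec' huy heσ heσ').elim
    · exact key hec hec' heσ heσ'
    · exact (hadj _ _ _ hec' hec huy heσ' heσ).elim
    · exact absurd rfl hne
    · exact (hadj _ _ _ hec hec' hxv heσ heσ').elim
    · exact key hec' hec heσ' heσ
    · exact (hadj _ _ _ hec' hec hxv heσ' heσ).elim
    · exact absurd rfl hne

/-! ### Exchanging an edge of a spanning tree -/

lemma reachable_deleteEdges_or {T : SimpleGraph V} {p q x : V}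
    (h : T.Reachable x p) : (T.deleteEdges {s(p, q)}).Reachable x p ∨
      (T.deleteEdges {s(p, q)}).Reachable x q := by
  obtain ⟨w⟩ := h
  induction w with
  | nil => exact Or.inl .rfl
  | @cons a b d hab w ih =>
    by_cases he : s(a, b) = s(d, q)
    · rw [Sym2.eq_iff] at he
      rcases he with ⟨rfl, rfl⟩ | ⟨rfl, rfl⟩
      · exact Or.inl .rfl
      · exact Or.inr .rfl
    · have hadj : (T.deleteEdges {s(d, q)}).Adj a b := by
        rw [deleteEdges_adj]
        exact ⟨hab, he⟩
      exact ih.imp hadj.reachable.trans hadj.reachable.trans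

lemma exists_crossing_edge {H L : SimpleGraph V} {u v : V} (h : H.Reachable u v)
    (hL : ¬ L.Reachable u v) : ∃ x y, H.Adj x y ∧ L.Reachable u x ∧ ¬ L.Reachable u y := by
  by_contra! hn
  have : ∀ x, ∀ w : H.Walk x v, L.Reachable u x → L.Reachable u v := by
    intro x w
    induction w with
    | nil => exact id
    | cons hab w ih => exact fun hx => ih h hL (hn _ _ hab hx)
  exact h.elim fun w => hL (this u w .rfl)

/-- If an edge `s(p, q)` of the spanning tree `T`, not a cut-edge of `G`, lies on the tree path
from `u` to `v`, then some edge of `G` outside `T` can replace it. -/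
lemma exists_exchange {T : SimpleGraph V} (hT : T.IsTree) (hTG : T ≤ G) {p q u v : V}
    (hcut : s(p, q) ∉ cutEdges G) {w : T.Walk u v} (hw : w.IsPath) (he : s(p, q) ∈ w.edges) :
    ∃ x y, G.Adj x y ∧ s(x, y) ∉ T.edgeSet ∧ ¬ (T.deleteEdges {s(p, q)}).Reachable x y ∧
      ∃ p' : G.Walk u v, p'.IsPath ∧ s(x, y) ∈ p'.edges ∧
        ∀ e ∈ p'.edges, e ≠ s(x, y) → e ∈ T.edgeSet := by
  classical
  set L := T.deleteEdges {s(p, q)} with hLdef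
  have hLT : L ≤ T := deleteEdges_le _
  have hpq : T.Adj p q := w.edges_subset_edgeSet he
  have hLuv : ¬ L.Reachable u v := by
    intro h
    obtain ⟨w', hw'⟩ := h.exists_isPath
    have h2 := congrArg Subtype.val ((hT.isAcyclic.subsingleton_path u v).elim
      ⟨w, hw⟩ ⟨w'.mapLe hLT, hw'.mapLe hLT⟩)
    simp only at h2
    rw [h2, Walk.edges_mapLe_eq_edges] at he
    have := w'.edges_subset_edgeSet he
    simp [hLdef] at this
  -- As `s(p, q)` is no bridge of `G`, the two halves of `T` left by its removal remain joined in
  -- `G`.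
  have hG : (G.deleteEdges {s(p, q)}).Reachable u v := by
    have hr : (G.deleteEdges {s(p, q)}).Reachable p q := by
      by_contra hn
      exact hcut ⟨hTG hpq, hn⟩
    have hL : L ≤ G.deleteEdges {s(p, q)} := deleteEdges_mono hTG
    have h1 : ∀ x, (G.deleteEdges {s(p, q)}).Reachable x p := by
      intro x
      rcases reachable_deleteEdges_or (q := q) (hT.connected x p) with h | h
      · exact h.mono hL
      · exact (h.mono hL).trans hr.symm
    exact (h1 u).trans (h1 v).symm
  obtain ⟨x, y, hxy, hux, huy⟩ := exists_crossing_edge hG hLuv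
  rw [deleteEdges_adj] at hxy
  have hLxy : ¬ L.Reachable x y := fun h => huy (hux.trans h)
  have hyv : L.Reachable y v := by
    have hall := fun z => reachable_deleteEdges_or (q := q) (hT.connected z p)
    rcases hall u with hu | hu <;> rcases hall v with hv | hv <;> rcases hall y with hy | hy
    · exact hy.trans hv.symm
    · exact absurd (hu.trans hv.symm) hLuv
    · exact absurd (hu.trans hy.symm) huy
    · exact hy.trans hv.symm
    · exact hy.trans hv.symm
    · exact absurd (hu.trans hy.symm) huy
    · exact absurd (hu.trans hv.symm) hLuv
    · exact hy.trans hv.symm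
  refine ⟨x, y, hxy.1, fun hT' => hLxy (Adj.reachable ?_), hLxy, ?_⟩
  · rw [hLdef, deleteEdges_adj]
    exact ⟨hT', hxy.2⟩
  · obtain ⟨p', hp', hm, hE⟩ :=
      exists_path_through_edge (hLT.trans hTG) hxy.1 hux hyv hLuv
    exact ⟨p', hp', hm, fun e he hne => edgeSet_mono hLT (hE e he hne)⟩

lemma cutEdges_subset_of_connected {T : SimpleGraph V} (hT : T.Connected) (hTG : T ≤ G) {e : Sym2 V}
    (he : e ∈ cutEdges G) : e ∈ T.edgeSet := by
  obtain ⟨a, b⟩ := e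
  obtain ⟨w⟩ := hT a b
  have := mem_edges_of_mem_cutEdges he (w.mapLe hTG)
  rw [Walk.edges_mapLe_eq_edges] at this
  exact w.edges_subset_edgeSet this

/-- Without cut-edges at both ends of an edge that is not a cut-edge, any proper colouring of the
cut-edges with at least two colours extends to a conflict-free connection colouring. -/
lemma exists_cfColoring_of_no_cutQuadruple [Finite V] (hconn : G.Connected) (hdiam : G.diam = 3)
    {κ : Type*} {σ ρ : κ} (hσρ : ρ ≠ σ) {c : Sym2 V → κ} (hc : ProperOnCuts G c)
    (hq : ∀ u a b v, ¬ CutQuadruple G u a b v) : ∃ c : Sym2 V → κ, IsCFConnectionColoring G c := by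
  classical
  obtain ⟨T, hTG, hT⟩ := hconn.exists_isTree_le
  -- Off the cut-edges `σ` marks the non-tree edges: the tree path has none, and an exchanged path
  -- has exactly one.
  let c' : Sym2 V → κ := fun e => if e ∈ cutEdges G then c e else if e ∈ T.edgeSet then ρ else σ
  have hcT : ∀ e, e ∉ cutEdges G → (c' e = σ ↔ e ∉ T.edgeSet) := by
    intro e he
    by_cases h : e ∈ T.edgeSet <;> simp [c', he, h, hσρ]
  refine ⟨c', isCFConnectionColoring_of_cutQuadruple (σ := σ) hconn hdiam ?_ ?_ ?_⟩
  · intro a b b' h h' hne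
    simpa [c', h, h'] using hc a b b' h h' hne
  · intro u v huv hcut
    obtain ⟨w, hw⟩ := hT.connected.exists_isPath u v
    have hex : ∃ e ∈ w.edges, e ∉ cutEdges G := by
      by_contra! hn
      exact hcut ⟨w.mapLe hTG, hw.mapLe hTG, by rwa [Walk.edges_mapLe_eq_edges]⟩
    obtain ⟨⟨p, q⟩, he, hne⟩ := hex
    refine ⟨⟨w.mapLe hTG, hw.mapLe hTG, ?_⟩, ?_⟩
    · rw [Walk.edges_mapLe_eq_edges]
      exact fun e he hec h => (hcT e hec).1 h (w.edges_subset_edgeSet he)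
    · obtain ⟨x, y, hxy, hT', -, p', hp', hm, hE⟩ := exists_exchange hT hTG hne hw he
      have hxc : s(x, y) ∉ cutEdges G :=
        fun h => hT' (cutEdges_subset_of_connected hT.connected hTG h)
      refine ⟨p', hp', _, hm, hxc, (hcT _ hxc).2 hT', fun e he hec hes => ?_⟩
      by_contra hne
      exact (hcT e hec).1 hes (hE e he hne)
  · exact fun u a b v h => absurd h (hq u a b v)

/-! ### Vertex colourings -/

/-- `a` and `b` are joined by a walk avoiding `z`. -/
def JoinedAvoiding (G : SimpleGraph V) (z a b : V) : Prop := ∃ w : G.Walk a b, z ∉ w.support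

lemma JoinedAvoiding.symm {z a b : V} (h : JoinedAvoiding G z a b) : JoinedAvoiding G z b a := by
  obtain ⟨w, hw⟩ := h
  exact ⟨w.reverse, by simpa using hw⟩

lemma JoinedAvoiding.trans {z a b d : V} (h : JoinedAvoiding G z a b)
    (h' : JoinedAvoiding G z b d) : JoinedAvoiding G z a d := by
  obtain ⟨w, hw⟩ := h
  obtain ⟨w', hw'⟩ := h'
  exact ⟨w.append w', by simp [Walk.mem_support_append_iff, hw, hw']⟩

lemma exists_path_to_first_hit (S : Set V) {a t : V} (w : G.Walk a t) (ht : t ∈ S) :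
    ∃ y ∈ S, ∃ q : G.Walk a y, q.IsPath ∧ (∀ x ∈ q.support, x ∈ w.support) ∧
      ∀ x ∈ q.support, x ∈ S → x = y := by
  classical
  suffices ∃ y ∈ S, ∃ q : G.Walk a y, (∀ x ∈ q.support, x ∈ w.support) ∧
      ∀ x ∈ q.support, x ∈ S → x = y by
    obtain ⟨y, hy, q, h1, h2⟩ := this
    exact ⟨y, hy, q.bypass, q.bypass_isPath, fun x hx => h1 x (q.support_bypass_subset_support hx),
      fun x hx => h2 x (q.support_bypass_subset_support hx)⟩
  induction w with
  | nil => exact ⟨_, ht, Walk.nil, by simp, by simp⟩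
  | @cons a b t h w ih =>
    by_cases ha : a ∈ S
    · exact ⟨a, ha, Walk.nil, by simp, by simp⟩
    · obtain ⟨y, hy, q, h1, h2⟩ := ih ht
      refine ⟨y, hy, Walk.cons h q, ?_, ?_⟩
      · intro x hx
        rw [Walk.support_cons, List.mem_cons] at hx ⊢
        exact hx.imp id (h1 x)
      · intro x hx hxS
        rw [Walk.support_cons, List.mem_cons] at hx
        rcases hx with rfl | hx
        · exact absurd hxS ha
        · exact h2 x hx hxS

lemma eq_of_mem_support_append {u z v x : V} {P₁ : G.Walk u z} {P₂ : G.Walk z v}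
    (hP : (P₁.append P₂).IsPath) (hx : x ∈ P₁.support) (hx' : x ∈ P₂.support) : x = z := by
  have hnd := hP.support_nodup
  rw [Walk.support_append, List.nodup_append] at hnd
  by_contra hne
  rw [← Walk.cons_tail_support, List.mem_cons] at hx'
  exact hnd.2.2 x hx x (hx'.resolve_left hne) rfl

/-- The new path follows `P₁` up to `y`, then `q` backwards to `c`, the edge from `c` to `z`, and
finally `P₂`. Since `q` meets the old path only in `y`, no vertex repeats. -/
lemma exists_path_through_adj_aux {u v z c y : V} {P₁ : G.Walk u z} {P₂ : G.Walk z v}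
    (hP : (P₁.append P₂).IsPath) (h : G.Adj z c) {q : G.Walk c y} (hq : q.IsPath)
    (hqP : ∀ x ∈ q.support, x ∈ (P₁.append P₂).support → x = y) (hz : z ∉ q.support)
    (hy : y ∈ P₁.support) :
    ∃ P : G.Walk u v, P.IsPath ∧ c ∈ P.support := by
  classical
  have hyz : y ≠ z := by rintro rfl; exact hz q.end_mem_support
  have hdis : ∀ x ∈ P₁.support, x ∈ P₂.support → x = z := fun x =>
    eq_of_mem_support_append hP
  have h1 := hP.of_append_left
  have hsub : ∀ x ∈ (P₁.takeUntil y hy).support, x ∈ P₁.support :=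
    fun x hx => P₁.support_takeUntil_subset_support hy hx
  have hzt : z ∉ (P₁.takeUntil y hy).support := Walk.endpoint_notMem_support_takeUntil h1 hy hyz.symm
  refine ⟨(P₁.takeUntil y hy).append (q.reverse.append (Walk.cons h.symm P₂)), ?_, ?_⟩
  · have hmem : ∀ x ∈ q.support, x ∉ P₂.support := by
      intro x hx hx2
      have := hqP x hx (by rw [Walk.mem_support_append_iff]; exact Or.inr hx2)
      subst this
      exact hyz (hdis _ hy hx2)
    have hp2 : (q.reverse.append (Walk.cons h.symm P₂)).IsPath := by
      rw [Walk.isPath_def, Walk.support_append, List.nodup_append]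
      refine ⟨hq.reverse.support_nodup, by simpa using hP.of_append_right.support_nodup, ?_⟩
      rintro x hx x' hx' rfl
      simp only [Walk.support_reverse, List.mem_reverse] at hx
      exact hmem x hx (by simpa using hx')
    rw [Walk.isPath_def, Walk.support_append, List.nodup_append]
    refine ⟨(h1.takeUntil hy).support_nodup, hp2.support_nodup.tail, ?_⟩
    rintro x hx x' hx' rfl
    have hnd := hp2.support_nodup
    rw [← Walk.cons_tail_support, List.nodup_cons] at hnd
    have hxy : x ≠ y := by rintro rfl; exact hnd.1 hx'
    have hx2 := List.mem_of_mem_tail hx'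
    rw [Walk.mem_support_append_iff] at hx2
    rcases hx2 with hx2 | hx2
    · refine hxy (hqP x (by simpa using hx2) ?_)
      rw [Walk.mem_support_append_iff]
      exact Or.inl (hsub x hx)
    · rw [Walk.support_cons, List.mem_cons] at hx2
      rcases hx2 with rfl | hx2
      · refine hxy (hqP x q.start_mem_support ?_)
        rw [Walk.mem_support_append_iff]
        exact Or.inl (hsub x hx)
      · exact hzt (hdis x (hsub x hx) hx2 ▸ hx)
  · simp [Walk.mem_support_append_iff]

/-- A path through `z` can be rerouted through a neighbour `c` of `z` that is joined to the path
by a walk avoiding `z`. -/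
lemma exists_path_through_adj {u v z c t : V} {P : G.Walk u v} (hP : P.IsPath) (hz : z ∈ P.support)
    (h : G.Adj z c) (ht : t ∈ P.support) (hj : JoinedAvoiding G z c t) :
    ∃ P : G.Walk u v, P.IsPath ∧ c ∈ P.support := by
  classical
  obtain ⟨w, hw⟩ := hj
  obtain ⟨y, hy, q, hq, hqw, hqP⟩ := exists_path_to_first_hit {x | x ∈ P.support} w ht
  have hzq : z ∉ q.support := fun h => hw (hqw z h)
  have hspec := P.take_spec hz
  have hP' : ((P.takeUntil z hz).append (P.dropUntil z hz)).IsPath := by rwa [hspec]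
  have hy' := hy
  rw [Set.mem_ofPred_eq, ← hspec, Walk.mem_support_append_iff] at hy'
  rcases hy' with hy' | hy'
  · exact exists_path_through_adj_aux hP' h hq (by rwa [hspec]) hzq hy'
  · have hrev : ((P.dropUntil z hz).reverse.append (P.takeUntil z hz).reverse).IsPath := by
      rw [← Walk.reverse_append]
      exact hP'.reverse
    obtain ⟨P', hP', hc⟩ := exists_path_through_adj_aux hrev h hq (by
      rw [← Walk.reverse_append, hspec]
      simpa using hqP) hzq (by simpa using hy')
    exact ⟨P'.reverse, hP'.reverse, by simpa using hc⟩

/-- The fan lemma for two paths: if no vertex `z ≠ c` separates `c` from `{u, v} \ {z}`, then some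
path from `u` to `v` passes through `c`. -/
lemma exists_path_through_vertex (hG : G.Connected) {u v c : V}
    (h : ∀ z, z ≠ c → ∃ t, (t = u ∨ t = v) ∧ JoinedAvoiding G z t c) :
    ∃ P : G.Walk u v, P.IsPath ∧ c ∈ P.support := by
  have key : ∀ z, ∀ w : G.Walk z c, w.IsPath → (∃ P : G.Walk u v, P.IsPath ∧ z ∈ P.support) →
      ∃ P : G.Walk u v, P.IsPath ∧ c ∈ P.support := by
    intro z w
    induction w with
    | nil => exact fun _ h => h
    | @cons z z' c hz w ih =>
      rintro hw ⟨P, hP, hzP⟩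
      rw [Walk.cons_isPath_iff] at hw
      have hzc : z ≠ c := by rintro rfl; exact hw.2 w.end_mem_support
      obtain ⟨t, ht, hj⟩ := h z hzc
      -- The path is rerouted one step closer to `c`: the rest of `w` leads from `z'` to `c` without
      -- `z`, and `c` is joined to an end of `P` without `z`.
      refine ih h hw.1 (exists_path_through_adj hP hzP hz (t := t) ?_ ?_)
      · rcases ht with rfl | rfl
        · exact P.start_mem_support
        · exact P.end_mem_support
      · exact JoinedAvoiding.trans ⟨w, hw.2⟩ hj.symm
  obtain ⟨w, hw⟩ := hG.exists_isPath u c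
  obtain ⟨P, hP⟩ := hG.exists_isPath u v
  exact key u w hw ⟨P, hP, P.start_mem_support⟩

/-- `z` is a cut-vertex: two other vertices are not joined by a walk avoiding `z`. -/
def IsCutVertex (G : SimpleGraph V) (z : V) : Prop :=
  ∃ a b, a ≠ z ∧ b ≠ z ∧ ¬ JoinedAvoiding G z a b

lemma IsCutVertex.exists_separated {z : V} (hz : IsCutVertex G z) (c : V) :
    ∃ y, y ≠ z ∧ ¬ JoinedAvoiding G z y c := by
  obtain ⟨a, b, ha, hb, hab⟩ := hz
  by_contra! hn
  exact hab ((hn a ha).trans (hn b hb).symm)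

lemma joinedAvoiding_of_not (hG : G.Connected) {t z c : V} (hzc : z ≠ c)
    (h : ¬ JoinedAvoiding G z t c) : JoinedAvoiding G c t z := by
  classical
  obtain ⟨r, hr⟩ := hG.exists_isPath t c
  by_cases hz : z ∈ r.support
  · exact ⟨r.takeUntil z hz, Walk.endpoint_notMem_support_takeUntil hr hz hzc.symm⟩
  · exact absurd ⟨r, hz⟩ h

/-- Every path from `t` to `y` must pass through both `z` and `c`. One of length at most three can
only be `t, z, c, y`, because `t` is not adjacent to `c`. -/
lemma adj_of_separated [Finite V] (hconn : G.Connected) (hdiam : G.diam = 3) {t z c y : V}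
    (htz : t ≠ z) (hzc : z ≠ c) (hyc : y ≠ c) (ht : ¬ JoinedAvoiding G z t c)
    (hy : ¬ JoinedAvoiding G c y z) : G.Adj t z ∧ G.Adj z c := by
  have h1 : ¬ JoinedAvoiding G z t y := fun h =>
    ht (h.trans (joinedAvoiding_of_not hconn hzc.symm hy))
  have h2 : ¬ JoinedAvoiding G c t y := fun h =>
    hy (h.symm.trans (joinedAvoiding_of_not hconn hzc ht))
  have htc : t ≠ c := by
    rintro rfl
    exact ht ⟨Walk.nil, by simpa using hzc⟩
  have hyz : y ≠ z := by
    rintro rfl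
    exact hy ⟨Walk.nil, by simpa using hzc.symm⟩
  obtain ⟨p, -, hl⟩ := exists_short_path hconn hdiam t y
  have m1 : z ∈ p.support := by
    by_contra h
    exact h1 ⟨p, h⟩
  have m2 : c ∈ p.support := by
    by_contra h
    exact h2 ⟨p, h⟩
  have htc' : ¬ G.Adj t c := fun h => ht ⟨Walk.cons h Walk.nil, by simp [htz.symm, hzc]⟩
  cases p with
  | nil => simp at m1; exact absurd m1.symm htz
  | cons g1 p =>
  cases p with
  | nil => simp at m1; rcases m1 with rfl | rfl <;> contradiction
  | cons g2 p =>
  cases p with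
  | nil => simp [htz.symm, hyz.symm, htc.symm, hyc.symm] at m1 m2; exact absurd (m1.trans m2.symm) hzc
  | cons g3 p =>
  cases p with
  | cons g4 p => simp at hl; omega
  | nil =>
    simp only [Walk.support_cons, Walk.support_nil, List.mem_cons, htz.symm, hyz.symm, htc.symm,
      hyc.symm, List.not_mem_nil, or_false, false_or] at m1 m2
    rcases m1 with rfl | rfl <;> rcases m2 with rfl | rfl
    · exact absurd rfl hzc
    · exact ⟨g1, g2⟩
    · exact absurd g1 htc'
    · exact absurd rfl hzc

lemma IsCutVertex.adj [Finite V] (hconn : G.Connected) (hdiam : G.diam = 3) {z c : V}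
    (hz : IsCutVertex G z) (hc : IsCutVertex G c) (hzc : z ≠ c) : G.Adj z c := by
  obtain ⟨t, ht, ht'⟩ := hz.exists_separated c
  obtain ⟨y, hy, hy'⟩ := hc.exists_separated z
  exact (adj_of_separated hconn hdiam ht hzc hy ht' hy').2

lemma vcfc_le_three [Finite V] (hconn : G.Connected) (hdiam : G.diam = 3) : vcfc G ≤ 3 := by
  classical
  obtain ⟨c, hc⟩ : ∃ c, (∃ z, IsCutVertex G z) → IsCutVertex G c := by
    by_cases h : ∃ z, IsCutVertex G z
    · obtain ⟨z, hz⟩ := h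
      exact ⟨z, fun _ => hz⟩
    · exact ⟨hconn.nonempty.some, fun h' => absurd h' h⟩
  -- Colour `2` is used on `c` alone, so any path through `c` is conflict-free. Otherwise the fan
  -- condition fails at some `z`, and the path through `z` has colours `0, 1, 0`, or `0, 1` if `z`
  -- is an end.
  let f : V → Fin 3 := fun x => if x = c then 2 else if IsCutVertex G x then 1 else 0
  have hf2 : ∀ x, f x = f c → x = c := by
    intro x hx
    by_contra hne
    by_cases hq : IsCutVertex G x <;> simp [f, hne, hq] at hx
  refine Nat.sInf_le ⟨f, fun u v huv => ?_⟩
  by_cases hfan : ∀ z, z ≠ c → ∃ t, (t = u ∨ t = v) ∧ JoinedAvoiding G z t c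
  · obtain ⟨P, hP, hcP⟩ := exists_path_through_vertex hconn hfan
    exact ⟨P, hP, c, hcP, fun y _ hy => hf2 y hy⟩
  push Not at hfan
  obtain ⟨z, hzc, hz⟩ := hfan
  have hzcut : IsCutVertex G z := by
    by_cases hu : u = z
    · exact ⟨v, c, fun h => huv (hu.trans h.symm), hzc.symm, hz v (Or.inr rfl)⟩
    · exact ⟨u, c, hu, hzc.symm, hz u (Or.inl rfl)⟩
  have hccut := hc ⟨z, hzcut⟩
  obtain ⟨y, hy, hy'⟩ := hccut.exists_separated z
  have hadj : ∀ t, (t = u ∨ t = v) → t ≠ z → G.Adj t z := fun t ht htz =>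
    (adj_of_separated hconn hdiam htz hzc hy (hz t ht) hy').1
  have hcol : ∀ t, (t = u ∨ t = v) → t ≠ z → f t = 0 := by
    intro t ht htz
    have htc : t ≠ c := by
      rintro rfl
      exact hz t ht ⟨Walk.nil, by simpa using hzc⟩
    have hcut : ¬ IsCutVertex G t := fun hcut =>
      hz t ht ⟨Walk.cons (hcut.adj hconn hdiam hccut htc) Walk.nil, by simp [htz.symm, hzc]⟩
    simp [f, htc, hcut]
  have hfz : f z = 1 := by simp [f, hzc, hzcut]
  by_cases huz : u = z
  · subst huz
    have hv := hcol v (Or.inr rfl) huv.symm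
    refine ⟨Walk.cons (hadj v (Or.inr rfl) huv.symm).symm Walk.nil, by simp [huv], u, by simp, ?_⟩
    intro x hx hxu
    simp only [Walk.support_cons, Walk.support_nil, List.mem_cons, List.not_mem_nil, or_false] at hx
    rcases hx with rfl | rfl
    · rfl
    · rw [hv, hfz] at hxu; exact absurd hxu (by decide)
  have hu := hcol u (Or.inl rfl) huz
  by_cases hvz : v = z
  · subst hvz
    refine ⟨Walk.cons (hadj u (Or.inl rfl) huz) Walk.nil, by simp [huv], v, by simp, ?_⟩
    intro x hx hxu
    simp only [Walk.support_cons, Walk.support_nil, List.mem_cons, List.not_mem_nil, or_false] at hx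
    rcases hx with rfl | rfl
    · rw [hu, hfz] at hxu; exact absurd hxu (by decide)
    · rfl
  have hv := hcol v (Or.inr rfl) hvz
  refine ⟨Walk.cons (hadj u (Or.inl rfl) huz) (Walk.cons (hadj v (Or.inr rfl) hvz).symm Walk.nil),
    by simp [huv, huz, Ne.symm hvz], z, by simp, ?_⟩
  intro x hx hxu
  simp only [Walk.support_cons, Walk.support_nil, List.mem_cons, List.not_mem_nil, or_false] at hx
  rcases hx with rfl | rfl | rfl
  · rw [hu, hfz] at hxu; exact absurd hxu (by decide)
  · rfl
  · rw [hv, hfz] at hxu; exact absurd hxu (by decide)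

/-! ### Pendant edges at a clique -/

/-- `y` is a vertex of degree one, adjacent to `a`. -/
def IsLeafAt (G : SimpleGraph V) (a y : V) : Prop := G.Adj a y ∧ ∀ z, G.Adj y z → z = a

lemma IsLeafAt.mem_cutEdges {a y : V} (h : IsLeafAt G a y) : s(a, y) ∈ cutEdges G := by
  refine ⟨h.1, ?_⟩
  rw [Sym2.eq_swap, isBridge_iff_forall_walk_mem_edges]
  intro p
  cases p with
  | nil => exact absurd rfl h.1.ne
  | cons g p => simp [h.2 _ g]

lemma CutQuadruple.symm {u a b v : V} (h : CutQuadruple G u a b v) : CutQuadruple G v b a u :=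
  ⟨Sym2.eq_swap ▸ h.right, Sym2.eq_swap ▸ h.left, h.adj.symm, Sym2.eq_swap ▸ h.not_cut, h.ne.symm⟩

lemma CutQuadruple.left_ne {u a b v : V} (h : CutQuadruple G u a b v) : u ≠ b := by
  rintro rfl
  exact h.not_cut (Sym2.eq_swap ▸ h.left)

lemma CutQuadruple.exists_path {u a b v : V} (h : CutQuadruple G u a b v) :
    ∃ p : G.Walk u v, p.IsPath ∧ p.edges = [s(u, a), s(a, b), s(b, v)] := by
  have h1 : G.Adj u a := h.left.1
  have h2 : G.Adj b v := h.right.1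
  refine ⟨Walk.cons h1 (Walk.cons h.adj (Walk.cons h2 Walk.nil)), ?_, rfl⟩
  simp [Walk.cons_isPath_iff, h1.ne, h2.ne, h.left_ne, h.symm.left_ne.symm, h.ne, h.adj.ne]

/-- A path from `y'` to `z` has to cross the bridge from `y` to `x`. Reaching `x` takes at least two
steps, so at most one is left. -/
lemma eq_or_adj_of_short_path [Finite V] (hconn : G.Connected) (hdiam : G.diam = 3)
    {x y y' z : V} (hxy : s(x, y) ∈ cutEdges G) (hy : G.Adj y y') (hyx : y' ≠ x)
    (hz : (G.deleteEdges {s(x, y)}).Reachable z x) : z = x ∨ G.Adj x z := by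
  set L := G.deleteEdges {s(x, y)} with hL
  have hLxy : ¬ L.Reachable x y := hxy.2
  have hLadj : ∀ a b, G.Adj a b → s(a, b) ≠ s(x, y) → L.Reachable a b := by
    intro a b h hne
    refine Adj.reachable ?_
    rw [hL, deleteEdges_adj]
    exact ⟨h, hne⟩
  have hyy' : L.Reachable y y' := hLadj _ _ hy (by
    rw [Sym2.eq_swap, Ne, Sym2.congr_left]
    exact hyx)
  obtain ⟨p, -, hl⟩ := exists_short_path hconn hdiam y' z
  have step : ∀ a b, G.Adj a b → L.Reachable y a → L.Reachable y b ∨ a = y ∧ b = x := by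
    intro a b h ha
    by_cases he : s(a, b) = s(x, y)
    · rw [Sym2.eq_iff] at he
      rcases he with ⟨rfl, rfl⟩ | ⟨rfl, rfl⟩
      · exact absurd ha.symm hLxy
      · exact Or.inr ⟨rfl, rfl⟩
    · exact Or.inl (ha.trans (hLadj _ _ h he))
  have hend : ¬ L.Reachable y z := fun h => hLxy (h.trans hz).symm
  cases p with
  | nil => exact absurd hyy' hend
  | cons g1 p =>
  rcases step _ _ g1 hyy' with h1 | ⟨h1, -⟩
  swap
  · exact absurd h1 hy.ne'
  cases p with
  | nil => exact absurd h1 hend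
  | cons g2 p =>
  rcases step _ _ g2 h1 with h2 | ⟨-, rfl⟩
  · cases p with
    | nil => exact absurd h2 hend
    | cons g3 p =>
    cases p with
    | cons g4 p => simp at hl; omega
    | nil =>
    rcases step _ _ g3 h2 with h3 | ⟨-, rfl⟩
    · exact absurd h3 hend
    · exact Or.inl rfl
  · cases p with
    | nil => exact Or.inl rfl
    | cons g3 p =>
    cases p with
    | cons g4 p => simp at hl; omega
    | nil => exact Or.inr g3

/-- Another neighbour of `y` would place `u` and `v` within distance one of `x`. The resulting walk
from `u` to `v` uses only edges at `x`, yet contains both cut-edges of the quadruple; hence `a = x =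
b`, which is absurd. -/
lemma CutQuadruple.isLeafAt_aux [Finite V] (hconn : G.Connected) (hdiam : G.diam = 3)
    {u a b v : V} (h : CutQuadruple G u a b v) {x y : V} (hxy : s(x, y) ∈ cutEdges G)
    (ha : (G.deleteEdges {s(x, y)}).Reachable a x) : IsLeafAt G x y := by
  refine ⟨hxy.1, ?_⟩
  by_contra! hn
  obtain ⟨y', hy, hyx⟩ := hn
  have key := fun z => eq_or_adj_of_short_path (z := z) hconn hdiam hxy hy hyx
  have hLadj : ∀ a b, G.Adj a b → s(a, b) ≠ s(x, y) →
      (G.deleteEdges {s(x, y)}).Reachable a b := by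
    intro a b h hne
    refine Adj.reachable ?_
    rw [deleteEdges_adj]
    exact ⟨h, hne⟩
  have hb : (G.deleteEdges {s(x, y)}).Reachable b x :=
    (hLadj _ _ h.adj (fun he => h.not_cut (he ▸ hxy))).symm.trans ha
  have hbad : ∀ {u a b v}, CutQuadruple G u a b v → (G.deleteEdges {s(x, y)}).Reachable a x →
      (G.deleteEdges {s(x, y)}).Reachable b x → (G.deleteEdges {s(x, y)}).Reachable u x := by
    intro u a b v h ha hb
    by_contra hu
    have he : s(u, a) = s(x, y) := by
      by_contra he
      exact hu ((hLadj _ _ h.left.1 he).trans ha)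
    rw [Sym2.eq_iff] at he
    rcases he with ⟨rfl, rfl⟩ | ⟨rfl, rfl⟩
    · exact hxy.2 ha.symm
    have hv : (G.deleteEdges {s(a, u)}).Reachable v a := by
      refine (hLadj _ _ h.right.1 ?_).symm.trans hb
      intro he
      rw [Sym2.eq_iff] at he
      rcases he with ⟨h1, -⟩ | ⟨h1, -⟩
      · exact h.adj.ne h1.symm
      · exact h.left_ne h1.symm
    rcases key v hv with rfl | hva
    · exact h.symm.left_ne rfl
    · have := mem_edges_of_mem_cutEdges h.right (Walk.cons h.adj.symm (Walk.cons hva Walk.nil))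
      simp only [Walk.edges_cons, Walk.edges_nil, List.mem_cons, List.not_mem_nil, or_false,
        Sym2.congr_right] at this
      rcases this with h1 | h1
      · exact h.symm.left_ne h1
      · rw [Sym2.congr_left] at h1
        exact h.adj.ne h1.symm
  have hu := key u (hbad h ha hb)
  have hv := key v (hbad h.symm hb ha)
  obtain ⟨W, hW⟩ : ∃ W : G.Walk u v, ∀ e ∈ W.edges, e = s(u, x) ∨ e = s(x, v) := by
    rcases hu with rfl | hu <;> rcases hv with rfl | hv
    · exact absurd rfl h.ne
    · exact ⟨Walk.cons hv Walk.nil, by simp⟩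
    · exact ⟨Walk.cons hu.symm Walk.nil, by simp⟩
    · exact ⟨Walk.cons hu.symm (Walk.cons hv Walk.nil), by simp⟩
  obtain ⟨p, hp, hpe⟩ := h.exists_path
  have e1 := hW _ (cutEdge_mem_edges hp h.left (by simp [hpe]) W)
  have e2 := hW _ (cutEdge_mem_edges hp h.right (by simp [hpe]) W)
  have h1 : a = x := by
    rcases e1 with e1 | e1
    · exact Sym2.congr_right.1 e1
    · rw [Sym2.eq_iff] at e1
      rcases e1 with ⟨-, h1⟩ | ⟨h1, -⟩
      · exact absurd h1.symm h.symm.left_ne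
      · exact absurd h1 h.ne
  have h2 : b = x := by
    rcases e2 with e2 | e2
    · rw [Sym2.eq_iff] at e2
      rcases e2 with ⟨h1, -⟩ | ⟨-, h1⟩
      · exact absurd h1.symm h.left_ne
      · exact absurd h1.symm h.ne
    · exact Sym2.congr_left.1 e2
  exact h.adj.ne (h1.trans h2.symm)

lemma CutQuadruple.isLeafAt_or [Finite V] (hconn : G.Connected) (hdiam : G.diam = 3)
    {u a b v : V} (h : CutQuadruple G u a b v) {x y : V} (hxy : s(x, y) ∈ cutEdges G) :
    IsLeafAt G x y ∨ IsLeafAt G y x := by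
  rcases reachable_deleteEdges_or (q := y) (hconn a x) with ha | ha
  · exact Or.inl (h.isLeafAt_aux hconn hdiam hxy ha)
  · rw [Sym2.eq_swap] at hxy ha
    exact Or.inr (h.isLeafAt_aux hconn hdiam hxy ha)

/-- Two adjacent vertices of degree one would be the whole connected graph, whose diameter is one.
-/
lemma IsLeafAt.not_isLeafAt [Finite V] (hconn : G.Connected) (hdiam : G.diam = 3) {a y b : V}
    (h : IsLeafAt G a y) : ¬ IsLeafAt G b a := by
  intro hb
  obtain rfl := hb.2 _ h.1
  have hall : ∀ z, z = a ∨ z = y := by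
    have : ∀ s t, ∀ w : G.Walk s t, (s = a ∨ s = y) → (t = a ∨ t = y) := by
      intro s t w
      induction w with
      | nil => exact id
      | cons g w ih =>
        rintro (rfl | rfl)
        · exact ih (Or.inr (hb.2 _ g))
        · exact ih (Or.inl (h.2 _ g))
    intro z
    obtain ⟨w⟩ := hconn a z
    exact this a z w (Or.inl rfl)
  have := hconn.nonempty
  obtain ⟨s, t, hst⟩ := G.exists_dist_eq_diam
  rw [hdiam] at hst
  have h1 := dist_eq_one_iff_adj.2 h.1
  have h2 := dist_eq_one_iff_adj.2 hb.1
  rcases hall s with rfl | rfl <;> rcases hall t with rfl | rfl <;>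
    simp_all

/-- The set of neighbours of vertices of degree one. -/
def supportVertices (G : SimpleGraph V) : Set V := {a | ∃ y, IsLeafAt G a y}

lemma not_mem_supportVertices [Finite V] (hconn : G.Connected) (hdiam : G.diam = 3) {a y : V}
    (h : IsLeafAt G a y) : y ∉ supportVertices G := fun ⟨_, hz⟩ => hz.not_isLeafAt hconn hdiam h

/-- A path of length at most three between leaves at `a` and at `b` spends its end edges at the
leaves, leaving one edge from `a` to `b`. -/
lemma adj_of_mem_supportVertices [Finite V] (hconn : G.Connected) (hdiam : G.diam = 3) {a b : V}
    (ha : a ∈ supportVertices G) (hb : b ∈ supportVertices G) (hab : a ≠ b) : G.Adj a b := by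
  have hb' := hb
  have ha' := ha
  obtain ⟨y, hy⟩ := ha
  obtain ⟨z, hz⟩ := hb
  have hza : z ≠ a := by rintro rfl; exact not_mem_supportVertices hconn hdiam hz ha'
  have hyb : y ≠ b := by rintro rfl; exact not_mem_supportVertices hconn hdiam hy hb'
  obtain ⟨p, -, hl⟩ := exists_short_path hconn hdiam y z
  cases p with
  | nil => exact absurd (hz.2 _ hy.1.symm) hab
  | cons g1 p =>
  obtain rfl := hy.2 _ g1
  cases p with
  | nil => exact absurd rfl hza
  | cons g2 p =>
  cases p with
  | nil => exact absurd (hz.2 _ g2.symm) hab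
  | cons g3 p =>
  cases p with
  | cons g4 p => simp at hl; omega
  | nil => exact (hz.2 _ g3.symm) ▸ g2

/-- Every cut-edge is a pendant edge. -/
def CutEdgesPendant (G : SimpleGraph V) : Prop :=
  ∀ x y, s(x, y) ∈ cutEdges G → IsLeafAt G x y ∨ IsLeafAt G y x

lemma not_mem_cutEdges_of_supportVertices [Finite V] (hconn : G.Connected) (hdiam : G.diam = 3)
    (hpend : CutEdgesPendant G) {a b : V} (ha : a ∈ supportVertices G)
    (hb : b ∈ supportVertices G) : s(a, b) ∉ cutEdges G := by
  intro h
  rcases hpend a b h with h | h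
  · exact not_mem_supportVertices hconn hdiam h hb
  · exact not_mem_supportVertices hconn hdiam h ha

lemma CutQuadruple.isLeafAt_left (hpend : CutEdgesPendant G) {u a b v : V}
    (h : CutQuadruple G u a b v) : IsLeafAt G a u := by
  rcases hpend _ _ h.left with h1 | h1
  · exact absurd (h1.2 _ h.adj).symm h.left_ne
  · exact h1

/-! ### Spanning trees containing a star on the clique -/

/-- The edges of `T` that do not join two vertices of `A`. -/
def offClique (T : SimpleGraph V) (A : Set V) : SimpleGraph V where
  Adj x y := T.Adj x y ∧ ¬ (x ∈ A ∧ y ∈ A)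
  symm := ⟨fun _ _ h => ⟨h.1.symm, fun h' => h.2 h'.symm⟩⟩
  loopless := ⟨fun _ h => T.loopless.irrefl _ h.1⟩

/-- `T` is a spanning tree of `G` whose edges inside the clique `A` form a star with centre `o`
spanning `A`; `r x` is the vertex of `A` to which `x` is attached. -/
structure IsCliqueTree (G : SimpleGraph V) (A : Set V) (o : V) (T : SimpleGraph V) (r : V → V) :
    Prop where
  le : T ≤ G
  isTree : T.IsTree
  center_mem : o ∈ A
  star : ∀ a ∈ A, a ≠ o → T.Adj o a
  root_mem : ∀ x, r x ∈ A
  reachable_root : ∀ x, (offClique T A).Reachable x (r x)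
  root_eq : ∀ x y, (offClique T A).Adj x y → r x = r y
  root_self : ∀ a ∈ A, r a = a

namespace IsCliqueTree

variable {A : Set V} {o : V} {T : SimpleGraph V} {r : V → V}

lemma eq_center (h : IsCliqueTree G A o T r) {a b : V} (ha : a ∈ A) (hb : b ∈ A) (hab : T.Adj a b) :
    a = o ∨ b = o := by
  by_contra! hn
  have h1 := (h.star a ha hn.1).symm
  have h2 := h.star b hb hn.2
  have hp : (Walk.cons hab Walk.nil : T.Walk a b).IsPath := by simp [hab.ne]
  have hq : (Walk.cons h1 (Walk.cons h2 Walk.nil) : T.Walk a b).IsPath := by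
    simp [Walk.cons_isPath_iff, hn.1, hn.2.symm, hab.ne]
  have := congrArg (fun p : T.Path a b => p.1.length)
    ((h.isTree.isAcyclic.subsingleton_path a b).elim ⟨_, hp⟩ ⟨_, hq⟩)
  simp at this

end IsCliqueTree

/-- The star is acyclic, hence extends to a spanning tree. Every star edge is a bridge of the tree,
so without the edges inside `A` each vertex reaches exactly one vertex of `A`, its root. -/
lemma exists_isCliqueTree (hconn : G.Connected) {A : Set V} {o : V} (ho : o ∈ A)
    (hA : ∀ a ∈ A, ∀ b ∈ A, a ≠ b → G.Adj a b) : ∃ T r, IsCliqueTree G A o T r := by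
  let S : SimpleGraph V :=
    { Adj := fun x y => x ≠ y ∧ x ∈ A ∧ y ∈ A ∧ (x = o ∨ y = o)
      symm := ⟨fun x y h => ⟨h.1.symm, h.2.2.1, h.2.1, h.2.2.2.symm⟩⟩
      loopless := ⟨fun x h => h.1 rfl⟩ }
  have hSG : S ≤ G := fun x y h => hA x h.2.1 y h.2.2.1 h.1
  have hS : S.IsAcyclic := (isAcyclic_starGraph o).anti fun x y h => by
    rw [starGraph_adj]
    exact ⟨h.1, h.2.2.2⟩
  obtain ⟨T, hST, hTG, hT⟩ := hconn.exists_isTree_le_of_le_of_isAcyclic hSG hS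
  have hstar : ∀ a ∈ A, a ≠ o → T.Adj o a := fun a ha hao =>
    hST ⟨hao.symm, ho, ha, Or.inl rfl⟩
  have hroot : ∀ x, ∃ a ∈ A, (offClique T A).Reachable x a := by
    have : ∀ x t, ∀ w : T.Walk x t, t ∈ A → ∃ a ∈ A, (offClique T A).Reachable x a := by
      intro x t w
      induction w with
      | nil => exact fun h => ⟨_, h, .rfl⟩
      | @cons x y t g w ih =>
        intro ht
        by_cases hx : x ∈ A
        · exact ⟨x, hx, .rfl⟩
        · obtain ⟨a, ha, hr⟩ := ih ht
          have g' : (offClique T A).Adj x y := ⟨g, fun h => hx h.1⟩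
          exact ⟨a, ha, g'.reachable.trans hr⟩
    intro x
    obtain ⟨w⟩ := hT.connected x o
    exact this x o w ho
  have hsep0 : ∀ a ∈ A, a ≠ o → ∀ b ∈ A, b ≠ a → ¬ (offClique T A).Reachable a b := by
    intro a ha hao b hb hba hr
    have hbr := isAcyclic_iff_forall_adj_isBridge.1 hT.isAcyclic (hstar a ha hao)
    refine hbr ?_
    have hle : offClique T A ≤ T.deleteEdges {s(o, a)} := by
      intro x y hxy
      rw [deleteEdges_adj]
      refine ⟨hxy.1, fun he => hxy.2 ?_⟩
      rw [Set.mem_singleton_iff, Sym2.eq_iff] at he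
      rcases he with ⟨rfl, rfl⟩ | ⟨rfl, rfl⟩
      · exact ⟨ho, ha⟩
      · exact ⟨ha, ho⟩
    refine Reachable.trans ?_ (hr.mono hle).symm
    by_cases hbo : b = o
    · rw [hbo]
    · refine Adj.reachable ?_
      rw [deleteEdges_adj]
      refine ⟨hstar b hb hbo, fun he => hba ?_⟩
      rw [Set.mem_singleton_iff] at he
      exact Sym2.congr_right.1 he
  have hsep : ∀ a ∈ A, ∀ b ∈ A, (offClique T A).Reachable a b → a = b := by
    intro a ha b hb hr
    by_contra hab
    by_cases hao : a = o
    · exact hsep0 b hb (fun h => hab (hao.trans h.symm)) a ha hab hr.symm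
    · exact hsep0 a ha hao b hb (Ne.symm hab) hr
  choose r hrA hr using hroot
  refine ⟨T, r, hTG, hT, ho, hstar, hrA, hr, fun x y hxy => ?_, fun a ha => ?_⟩
  · exact hsep _ (hrA x) _ (hrA y) ((hr x).symm.trans (hxy.reachable.trans (hr y)))
  · exact (hsep _ ha _ (hrA a) (hr a)).symm

/-! ### Linking clique vertices through one edge of the distinguished colour -/

/-- The edges inside `A` not coloured `σ` and not crossing the cut `χ`. -/
def linkGraph {κ : Type*} (A : Set V) (c : Sym2 V → κ) (σ : κ) (χ : V → Prop) : SimpleGraph V where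
  Adj p q := p ≠ q ∧ p ∈ A ∧ q ∈ A ∧ c s(p, q) ≠ σ ∧ (χ p ↔ χ q)
  symm := ⟨fun _ _ h => ⟨h.1.symm, h.2.2.1, h.2.1, Sym2.eq_swap ▸ h.2.2.2.1, h.2.2.2.2.symm⟩⟩
  loopless := ⟨fun _ h => h.1 rfl⟩

/-- `a` and `b` can be joined through an edge of colour `σ` that is not a cut-edge. -/
def Linked {κ : Type*} (G : SimpleGraph V) (A : Set V) (r : V → V) (c : Sym2 V → κ) (σ : κ)
    (a b : V) : Prop :=
  ∃ (χ : V → Prop) (x y : V), G.Adj x y ∧ s(x, y) ∉ cutEdges G ∧ c s(x, y) = σ ∧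
    (linkGraph A c σ χ).Reachable a (r x) ∧ (linkGraph A c σ χ).Reachable (r y) b ∧ χ a ∧ ¬ χ b

lemma Linked.symm {κ : Type*} {A : Set V} {r : V → V} {c : Sym2 V → κ} {σ : κ} {a b : V}
    (h : Linked G A r c σ a b) : Linked G A r c σ b a := by
  obtain ⟨χ, x, y, hxy, hc, hσ, h1, h2, ha, hb⟩ := h
  have hle : linkGraph A c σ χ ≤ linkGraph A c σ (fun z => ¬ χ z) := fun p q h =>
    ⟨h.1, h.2.1, h.2.2.1, h.2.2.2.1, not_congr h.2.2.2.2⟩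
  exact ⟨fun z => ¬ χ z, y, x, hxy.symm, Sym2.eq_swap ▸ hc, Sym2.eq_swap ▸ hσ,
    (h2.mono hle).symm, (h1.mono hle).symm, hb, not_not.2 ha⟩

lemma exists_cut_path_of_reachable {u v : V} (h : (cutEdgeSubgraph G).spanningCoe.Reachable u v) :
    ∃ p : G.Walk u v, p.IsPath ∧ ∀ e ∈ p.edges, e ∈ cutEdges G := by
  obtain ⟨p, hp⟩ := h.exists_isPath
  refine ⟨p.mapLe (cutEdgeSubgraph G).spanningCoe_le, hp.mapLe _, fun e he => ?_⟩
  rw [Walk.edges_mapLe_eq_edges] at he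
  have := p.edges_subset_edgeSet he
  induction e with
  | h a b => exact this

/-- Tree paths avoid `σ` off the cut-edges. If the tree path has a non-cut-edge not inside `A`, an
exchange yields the path with one `σ`; otherwise its ends are vertices of `A` or leaves at them, and
`hlink` applies. The condition `hcol` supplies a detour for quadruples all of whose three edges have
colour `σ`. -/
lemma isCFConnectionColoring_of_isCliqueTree [Finite V] (hconn : G.Connected) (hdiam : G.diam = 3)
    (hpend : CutEdgesPendant G) {o : V} {T : SimpleGraph V} {r : V → V}
    (hT : IsCliqueTree G (supportVertices G) o T r) {κ : Type*} {c : Sym2 V → κ} {σ : κ}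
    (hc : ProperOnCuts G c)
    (hoff : ∀ x y, G.Adj x y → s(x, y) ∉ cutEdges G →
      ¬ (x ∈ supportVertices G ∧ y ∈ supportVertices G) → (c s(x, y) = σ ↔ ¬ T.Adj x y))
    (hstar : ∀ a ∈ supportVertices G, a ≠ o → c s(o, a) ≠ σ)
    (hlink : ∀ a ∈ supportVertices G, ∀ b ∈ supportVertices G, a ≠ b →
      Linked G (supportVertices G) r c σ a b)
    (hcol : ∀ a b u v, a ≠ b → IsLeafAt G a u → IsLeafAt G b v → c s(a, u) = σ → c s(b, v) = σ →
      c s(a, b) = σ →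
      ∃ w ∈ supportVertices G, w ≠ a ∧ w ≠ b ∧ c s(a, w) ≠ c s(w, b)) :
    IsCFConnectionColoring G c := by
  set A := supportVertices G with hA
  have hAadj := fun a b (ha : a ∈ A) (hb : b ∈ A) (hab : a ≠ b) =>
    adj_of_mem_supportVertices hconn hdiam ha hb hab
  have hAcut := fun a b (ha : a ∈ A) (hb : b ∈ A) =>
    not_mem_cutEdges_of_supportVertices hconn hdiam hpend ha hb
  have hTc : ∀ x y, T.Adj x y → s(x, y) ∉ cutEdges G → c s(x, y) ≠ σ := by
    intro x y hxy hcut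
    by_cases hmem : x ∈ A ∧ y ∈ A
    · rcases hT.eq_center hmem.1 hmem.2 hxy with rfl | rfl
      · exact hstar _ hmem.2 hxy.ne'
      · rw [Sym2.eq_swap]
        exact hstar _ hmem.1 hxy.ne
    · exact fun h => (hoff x y (hT.le hxy) hcut hmem).1 h hxy
  have hcutT : ∀ x y, s(x, y) ∈ cutEdges G → T.Adj x y := fun x y h =>
    cutEdges_subset_of_connected hT.isTree.connected hT.le h
  refine isCFConnectionColoring_of_cutQuadruple (σ := σ) hconn hdiam hc ?_ ?_
  · intro u v huv hnc
    obtain ⟨w, hw⟩ := hT.isTree.connected.exists_isPath u v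
    refine ⟨⟨w.mapLe hT.le, hw.mapLe hT.le, ?_⟩, ?_⟩
    · rw [Walk.edges_mapLe_eq_edges]
      rintro ⟨x, y⟩ he hcut
      exact hTc x y (w.edges_subset_edgeSet he) hcut
    by_cases hex : ∃ x y, s(x, y) ∈ w.edges ∧ s(x, y) ∉ cutEdges G ∧ ¬ (x ∈ A ∧ y ∈ A)
    · obtain ⟨p, q, he, hcut, hpq⟩ := hex
      obtain ⟨x, y, hxy, hxT, hsep, p', hp', hm, hE⟩ := exists_exchange hT.isTree hT.le hcut hw he
      have hxcut : s(x, y) ∉ cutEdges G := fun h => hxT (hcutT x y h)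
      -- The star survives the removal of `s(p, q)`, so an edge inside `A` cannot reconnect the two
      -- halves.
      have hxA : ¬ (x ∈ A ∧ y ∈ A) := by
        rintro ⟨hx, hy⟩
        have hr : ∀ a ∈ A, (T.deleteEdges {s(p, q)}).Reachable o a := by
          intro a ha
          by_cases hao : a = o
          · rw [hao]
          · refine Adj.reachable ?_
            rw [deleteEdges_adj]
            refine ⟨hT.star a ha hao, fun h => hpq ?_⟩
            rw [Set.mem_singleton_iff, Sym2.eq_iff] at h
            rcases h with ⟨rfl, rfl⟩ | ⟨rfl, rfl⟩
            · exact ⟨hT.center_mem, ha⟩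
            · exact ⟨ha, hT.center_mem⟩
        exact hsep ((hr x hx).symm.trans (hr y hy))
      refine ⟨p', hp', _, hm, hxcut, (hoff x y hxy hxcut hxA).2 hxT, ?_⟩
      rintro ⟨s, t⟩ he hec hes
      by_contra hne
      exact hTc s t (hE _ he hne) hec hes
    · have hcl : ∀ {u v : V}, u ≠ v → ∀ w : T.Walk u v,
          (∀ x y, s(x, y) ∈ w.edges → s(x, y) ∉ cutEdges G → x ∈ A ∧ y ∈ A) →
          ∃ a ∈ A, a = u ∨ IsLeafAt G a u := by
        intro u v huv w hw
        cases w with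
        | nil => exact absurd rfl huv
        | @cons _ z _ g w =>
          by_cases hcut : s(u, z) ∈ cutEdges G
          · rcases hpend _ _ hcut with h | h
            · exact ⟨u, ⟨_, h⟩, Or.inl rfl⟩
            · exact ⟨z, ⟨_, h⟩, Or.inr h⟩
          · exact ⟨u, (hw u z (by simp) hcut).1, Or.inl rfl⟩
      have hw' : ∀ x y, s(x, y) ∈ w.edges → s(x, y) ∉ cutEdges G → x ∈ A ∧ y ∈ A := by
        intro x y h1 h2
        by_contra h3
        exact hex ⟨x, y, h1, h2, h3⟩
      obtain ⟨a, ha, hau⟩ := hcl huv w hw'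
      obtain ⟨b, hb, hbv⟩ := hcl huv.symm w.reverse (by simpa using hw')
      have hroot : ∀ a ∈ A, ∀ u, (a = u ∨ IsLeafAt G a u) → r u = a ∧
          (cutEdgeSubgraph G).spanningCoe.Reachable a u := by
        rintro a ha u (rfl | h)
        · exact ⟨hT.root_self a ha, .rfl⟩
        · refine ⟨?_, Adj.reachable (show s(a, u) ∈ cutEdges G from h.mem_cutEdges)⟩
          rw [← hT.root_eq a u ⟨hcutT _ _ h.mem_cutEdges, fun h' =>
            not_mem_supportVertices hconn hdiam h h'.2⟩, hT.root_self a ha]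
      obtain ⟨hru, hcu⟩ := hroot a ha u hau
      obtain ⟨hrv, hcv⟩ := hroot b hb v hbv
      have hab : a ≠ b := by
        rintro rfl
        exact hnc (exists_cut_path_of_reachable (hcu.symm.trans hcv))
      obtain ⟨χ, x, y, hxy, hxc, hxσ, h1, h2, hχa, hχb⟩ := hlink a ha b hb hab
      set N := linkGraph A c σ χ with hN
      set F := offClique T A with hF
      have hLG : F ⊔ N ≤ G := by
        refine sup_le (fun x y h => hT.le h.1) fun x y h => hAadj x y h.2.1 h.2.2.1 h.1
      have hux : (F ⊔ N).Reachable u x :=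
        ((hT.reachable_root u).mono le_sup_left).trans (((hru ▸ h1).mono le_sup_right).trans
          ((hT.reachable_root x).mono le_sup_left).symm)
      have hyv : (F ⊔ N).Reachable y v :=
        ((hT.reachable_root y).mono le_sup_left).trans (((hrv ▸ h2).mono le_sup_right).trans
          ((hT.reachable_root v).mono le_sup_left).symm)
      -- The side of the root with respect to `χ` never changes along `F ⊔ N`; a path from `u` to
      -- `v` therefore has to use `s(x, y)`.
      have huv' : ¬ (F ⊔ N).Reachable u v := by
        have hinv : ∀ s t, ∀ w : (F ⊔ N).Walk s t, (χ (r s) ↔ χ (r t)) := by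
          intro s t w
          induction w with
          | nil => exact Iff.rfl
          | @cons s s' t g w ih =>
            refine Iff.trans ?_ ih
            rcases g with g | g
            · rw [hT.root_eq _ _ g]
            · rw [hT.root_self _ g.2.1, hT.root_self _ g.2.2.1]
              exact g.2.2.2.2
        rintro ⟨w⟩
        have := hinv u v w
        rw [hru, hrv] at this
        exact hχb (this.1 hχa)
      obtain ⟨p, hp, hm, hE⟩ := exists_path_through_edge hLG hxy hux hyv huv'
      refine ⟨p, hp, _, hm, hxc, hxσ, ?_⟩
      rintro ⟨s, t⟩ he hec hes
      by_contra hne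
      rcases hE _ he hne with g | g
      · exact hTc s t g.1 hec hes
      · exact g.2.2.2.1 hes
  · intro u a b v h hua hbv
    have hu := h.isLeafAt_left hpend
    have hv := h.symm.isLeafAt_left hpend
    by_cases hab : c s(a, b) = σ
    swap
    · obtain ⟨p, hp, hpe⟩ := h.exists_path
      refine ⟨p, hp, s(a, b), by simp [hpe], ?_⟩
      simp only [hpe, List.mem_cons, List.not_mem_nil, or_false]
      rintro e (rfl | rfl | rfl) he
      · exact absurd (he.symm.trans hua) hab
      · rfl
      · exact absurd (he.symm.trans hbv) hab
    · have haA : a ∈ A := ⟨u, hu⟩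
      have hbA : b ∈ A := ⟨v, hv⟩
      obtain ⟨w, hw, hwa, hwb, hne⟩ := hcol a b u v h.adj.ne hu hv (Sym2.eq_swap ▸ hua) hbv hab
      have hg1 := hAadj a w haA hw hwa.symm
      have hg2 := hAadj w b hw hbA hwb
      have huA : u ∉ A := not_mem_supportVertices hconn hdiam hu
      have hvA : v ∉ A := not_mem_supportVertices hconn hdiam hv
      have huw : u ≠ w := fun h => huA (h ▸ hw)
      have hwv : w ≠ v := fun h => hvA (h ▸ hw)
      -- The detour through `w` has colours `σ`, `c s(a, w)`, `c s(w, b)`, `σ`. The two inner ones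
      -- differ, so one of them is not `σ` and occurs once.
      refine ⟨Walk.cons hu.1.symm (Walk.cons hg1 (Walk.cons hg2 (Walk.cons hv.1 Walk.nil))), ?_, ?_⟩
      · simp [Walk.cons_isPath_iff, hu.1.ne', hv.1.ne, huw, hwa.symm, hwb, hwv, h.ne, h.left_ne,
          h.symm.left_ne.symm, h.adj.ne]
      · simp only [Walk.edges_cons, Walk.edges_nil]
        by_cases hσ : c s(a, w) = σ
        · have hσ' : c s(w, b) ≠ σ := fun h => hne (hσ.trans h.symm)
          refine ⟨s(w, b), by simp, ?_⟩
          simp only [List.mem_cons, List.not_mem_nil, or_false]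
          rintro e (rfl | rfl | rfl | rfl) he
          · exact absurd (he.symm.trans hua) hσ'
          · exact absurd he hne
          · rfl
          · exact absurd (he.symm.trans hbv) hσ'
        · refine ⟨s(a, w), by simp, ?_⟩
          simp only [List.mem_cons, List.not_mem_nil, or_false]
          rintro e (rfl | rfl | rfl | rfl) he
          · exact absurd (he.symm.trans hua) hσ
          · rfl
          · exact absurd he.symm hne
          · exact absurd (he.symm.trans hbv) hσ

/-- The cut separates `{a, r x}` from the rest, so that `a` steps directly to `r x` and `r y` to
`b`. If `a = r y` or `b = r x`, the roles of `a` and `b` are exchanged. -/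
lemma linked_of_crossing_edge {κ : Type*} {A : Set V} {r : V → V} {c : Sym2 V → κ} {σ : κ}
    {x y : V} (hxy : G.Adj x y) (hcut : s(x, y) ∉ cutEdges G) (hσ : c s(x, y) = σ)
    (hr : ∀ x, r x ∈ A) (hne : r x ≠ r y)
    (hN : ∀ p ∈ A, ∀ q ∈ A, p ≠ q → s(p, q) ≠ s(r x, r y) → c s(p, q) ≠ σ) {a b : V}
    (ha : a ∈ A) (hb : b ∈ A) (hab : a ≠ b) : Linked G A r c σ a b := by
  have key : ∀ a ∈ A, ∀ b ∈ A, a ≠ b → a ≠ r y → b ≠ r x → Linked G A r c σ a b := by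
    intro a ha b hb hab hay hbx
    refine ⟨fun z => z = a ∨ z = r x, x, y, hxy, hcut, hσ, ?_, ?_, Or.inl rfl,
      not_or.2 ⟨hab.symm, hbx⟩⟩
    · by_cases h : a = r x
      · rw [h]
      · refine Adj.reachable ⟨h, ha, hr x, hN a ha _ (hr x) h ?_, by simp⟩
        rw [Sym2.eq_swap, Ne, Sym2.congr_right]
        exact hay
    · by_cases h : r y = b
      · rw [h]
      · refine Adj.reachable ⟨h, hr y, hb, hN _ (hr y) b hb h ?_, ?_⟩
        · rw [Sym2.eq_swap, Ne, Sym2.congr_left]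
          exact hbx
        · simp [hay.symm, hne.symm, hab.symm, hbx]
  by_cases h : a ≠ r y ∧ b ≠ r x
  · exact key a ha b hb hab h.1 h.2
  · refine (key b hb a ha hab.symm ?_ ?_).symm
    · rintro rfl
      exact h ⟨hab, hne.symm⟩
    · rintro rfl
      exact h ⟨hne, hab.symm⟩

/-- If `a` is some `vᵢ`, the cut isolates it and one of the two special edges leaves it; from `v₂`
one continues through the fourth vertex `o`, since both edges from `v₂` to `v₁` and `v₃` have colour
`σ`. When neither end is a `vᵢ`, the cut `{a, v₁}` serves. -/
lemma linked_of_two_edges {κ : Type*} {A : Set V} {r : V → V} {c : Sym2 V → κ} {σ : κ}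
    (hadj : ∀ a ∈ A, ∀ b ∈ A, a ≠ b → G.Adj a b) (hcut : ∀ a ∈ A, ∀ b ∈ A, s(a, b) ∉ cutEdges G)
    (hr : ∀ a ∈ A, r a = a) {v₁ v₂ v₃ o : V} (h₁ : v₁ ∈ A) (h₂ : v₂ ∈ A) (h₃ : v₃ ∈ A)
    (ho : o ∈ A) (h₁₂ : v₁ ≠ v₂) (h₂₃ : v₂ ≠ v₃) (h₁₃ : v₁ ≠ v₃) (ho₁ : o ≠ v₁) (ho₂ : o ≠ v₂)
    (ho₃ : o ≠ v₃) (hσ : ∀ a ∈ A, ∀ b ∈ A, a ≠ b →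
      (c s(a, b) = σ ↔ s(a, b) = s(v₁, v₂) ∨ s(a, b) = s(v₂, v₃))) {a b : V}
    (ha : a ∈ A) (hb : b ∈ A) (hab : a ≠ b) : Linked G A r c σ a b := by
  have hN : ∀ χ : V → Prop, ∀ p ∈ A, ∀ q ∈ A, (p ≠ v₂ ∧ q ≠ v₂ ∨ p ≠ v₁ ∧ q ≠ v₁ ∧ p ≠ v₃ ∧ q ≠ v₃) →
      (χ p ↔ χ q) → (linkGraph A c σ χ).Reachable p q := by
    intro χ p hp q hq hv hχ
    by_cases hpq : p = q
    · rw [hpq]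
    · refine Adj.reachable ⟨hpq, hp, hq, fun h => ?_, hχ⟩
      have := (hσ p hp q hq hpq).1 h
      simp only [Sym2.eq_iff] at this
      grind
  have hc₁₂ : c s(v₁, v₂) = σ := (hσ _ h₁ _ h₂ h₁₂).2 (Or.inl rfl)
  have hc₂₃ : c s(v₂, v₃) = σ := (hσ _ h₂ _ h₃ h₂₃).2 (Or.inr rfl)
  have k2 : ∀ b ∈ A, b ≠ v₂ → Linked G A r c σ v₂ b := by
    intro b hb hb2
    refine ⟨fun z => z = v₂, v₂, v₁, hadj _ h₂ _ h₁ h₁₂.symm, hcut _ h₂ _ h₁,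
      Sym2.eq_swap ▸ hc₁₂, ?_, ?_, rfl, hb2⟩
    · rw [hr _ h₂]
    · rw [hr _ h₁]
      exact hN _ _ h₁ _ hb (Or.inl ⟨h₁₂, hb2⟩) (by simp [h₁₂, hb2])
  have kend : ∀ v ∈ A, (v = v₁ ∨ v = v₃) → v ≠ v₂ → c s(v, v₂) = σ → o ≠ v →
      ∀ b ∈ A, b ≠ v → b ≠ v₂ → Linked G A r c σ v b := by
    intro v hv hv13 hv2 hc hov b hb hbv hb2
    refine ⟨fun z => z = v, v, v₂, hadj _ hv _ h₂ hv2, hcut _ hv _ h₂, hc, ?_, ?_, rfl, hbv⟩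
    · rw [hr _ hv]
    · rw [hr _ h₂]
      exact (hN _ _ h₂ _ ho (Or.inr ⟨h₁₂.symm, ho₁, h₂₃, ho₃⟩) (by simp [hv2.symm, hov])).trans
        (hN _ _ ho _ hb (Or.inl ⟨ho₂, hb2⟩) (by simp [hov, hbv]))
  have k1 := kend v₁ h₁ (Or.inl rfl) h₁₂ hc₁₂ ho₁
  have k3 := kend v₃ h₃ (Or.inr rfl) h₂₃.symm (Sym2.eq_swap ▸ hc₂₃) ho₃
  by_cases ha2 : a = v₂
  · subst ha2; exact k2 b hb hab.symm
  by_cases hb2 : b = v₂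
  · subst hb2; exact (k2 a ha hab).symm
  by_cases ha1 : a = v₁
  · subst ha1; exact k1 b hb hab.symm hb2
  by_cases hb1 : b = v₁
  · subst hb1; exact (k1 a ha hab ha2).symm
  by_cases ha3 : a = v₃
  · subst ha3; exact k3 b hb hab.symm hb2
  by_cases hb3 : b = v₃
  · subst hb3; exact (k3 a ha hab ha2).symm
  refine ⟨fun z => z = a ∨ z = v₁, v₁, v₂, hadj _ h₁ _ h₂ h₁₂, hcut _ h₁ _ h₂, hc₁₂, ?_, ?_,
    Or.inl rfl, not_or.2 ⟨hab.symm, hb1⟩⟩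
  · rw [hr _ h₁]
    exact hN _ _ ha _ h₁ (Or.inl ⟨ha2, h₁₂⟩) (by simp)
  · rw [hr _ h₂]
    exact hN _ _ h₂ _ hb (Or.inr ⟨h₁₂.symm, hb1, h₂₃, hb3⟩)
      (by simp [Ne.symm ha2, h₁₂.symm, hab.symm, hb1])

/-! ### Colourings built from a clique tree -/

open Classical in
/-- The colouring that agrees with `c` on cut-edges, gives colour `σ` to the edges of `E` and to
all edges neither in `T` nor inside `A`, colour `τ` to `g`, and colour `ρ` to the other edges. -/
noncomputable def cliqueTreeColoring {κ : Type*} (G : SimpleGraph V) (A : Set V)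
    (T : SimpleGraph V) (c : Sym2 V → κ) (E : Set (Sym2 V)) (g : Sym2 V) (σ τ ρ : κ) :
    Sym2 V → κ := fun e =>
  if e ∈ cutEdges G then c e else if e ∈ E then σ else if e = g then τ
    else if e ∈ T.edgeSet ∨ ∀ x ∈ e, x ∈ A then ρ else σ

lemma cliqueTreeColoring_cut {κ : Type*} {A : Set V} {T : SimpleGraph V} {c : Sym2 V → κ}
    {E : Set (Sym2 V)} {g : Sym2 V} {σ τ ρ : κ} {e : Sym2 V} (he : e ∈ cutEdges G) :
    cliqueTreeColoring G A T c E g σ τ ρ e = c e := by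
  simp [cliqueTreeColoring, he]

open Classical in
lemma cliqueTreeColoring_inside {κ : Type*} {A : Set V} {T : SimpleGraph V} {c : Sym2 V → κ}
    {E : Set (Sym2 V)} {g : Sym2 V} {σ τ ρ : κ} {a b : V} (hcut : s(a, b) ∉ cutEdges G)
    (ha : a ∈ A) (hb : b ∈ A) (hE : s(a, b) ∉ E) :
    cliqueTreeColoring G A T c E g σ τ ρ s(a, b) = if s(a, b) = g then τ else ρ := by
  have : ∀ x ∈ s(a, b), x ∈ A := by
    intro x hx
    rcases Sym2.mem_iff.1 hx with rfl | rfl <;> assumption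
  have h3 : s(a, b) ∈ T.edgeSet ∨ ∀ x ∈ s(a, b), x ∈ A := Or.inr this
  rw [cliqueTreeColoring, if_neg hcut, if_neg hE, if_pos h3]

lemma cliqueTreeColoring_inside_iff {κ : Type*} {A : Set V} {T : SimpleGraph V} {c : Sym2 V → κ}
    {E : Set (Sym2 V)} {g : Sym2 V} {σ τ ρ : κ} (hτ : τ ≠ σ) (hρ : ρ ≠ σ) {a b : V}
    (hcut : s(a, b) ∉ cutEdges G) (ha : a ∈ A) (hb : b ∈ A) :
    cliqueTreeColoring G A T c E g σ τ ρ s(a, b) = σ ↔ s(a, b) ∈ E := by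
  by_cases hE : s(a, b) ∈ E
  · simp [cliqueTreeColoring, hcut, hE]
  · rw [cliqueTreeColoring_inside hcut ha hb hE]
    split_ifs <;> simp [hτ, hρ, hE]

lemma cliqueTreeColoring_outside_iff {κ : Type*} {A : Set V} {T : SimpleGraph V} {c : Sym2 V → κ}
    {E : Set (Sym2 V)} {g : Sym2 V} {σ τ ρ : κ} (hρ : ρ ≠ σ)
    (hE : ∀ e ∈ E, ∀ x ∈ e, x ∈ A) (hg : ∀ x ∈ g, x ∈ A) {a b : V}
    (hcut : s(a, b) ∉ cutEdges G) (hab : ¬ (a ∈ A ∧ b ∈ A)) :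
    cliqueTreeColoring G A T c E g σ τ ρ s(a, b) = σ ↔ ¬ T.Adj a b := by
  have h1 : s(a, b) ∉ E := fun h =>
    hab ⟨hE _ h a (Sym2.mem_mk_left _ _), hE _ h b (Sym2.mem_mk_right _ _)⟩
  have h2 : s(a, b) ≠ g := by
    rintro rfl
    exact hab ⟨hg a (Sym2.mem_mk_left _ _), hg b (Sym2.mem_mk_right _ _)⟩
  have h3 : ¬ ∀ x ∈ s(a, b), x ∈ A := fun h =>
    hab ⟨h a (Sym2.mem_mk_left _ _), h b (Sym2.mem_mk_right _ _)⟩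
  by_cases h4 : T.Adj a b
  · simp [cliqueTreeColoring, hcut, h1, h2, h4, hρ]
  · simp only [cliqueTreeColoring, hcut, h1, h2, if_false, mem_edgeSet, h4, h3, or_self,
      not_false_eq_true]

/-- The edges of `E` stay inside `A` and avoid `o`, so the star is free of `σ`, and the conditions
on the colouring reduce to linking and to detours around `E`. -/
lemma IsCliqueTree.isCFConnectionColoring [Finite V] (hconn : G.Connected) (hdiam : G.diam = 3)
    (hpend : CutEdgesPendant G) {o : V} {T : SimpleGraph V} {r : V → V}
    (hT : IsCliqueTree G (supportVertices G) o T r) {κ : Type*} {c : Sym2 V → κ} {σ τ ρ : κ}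
    (hτ : τ ≠ σ) (hρ : ρ ≠ σ) (hc : ProperOnCuts G c) {E : Set (Sym2 V)} {g : Sym2 V}
    (hE : ∀ e ∈ E, ∀ x ∈ e, x ∈ supportVertices G ∧ x ≠ o) (hg : ∀ x ∈ g, x ∈ supportVertices G)
    (hlink : ∀ a ∈ supportVertices G, ∀ b ∈ supportVertices G, a ≠ b →
      Linked G (supportVertices G) r
        (cliqueTreeColoring G (supportVertices G) T c E g σ τ ρ) σ a b)
    (hcol : ∀ a b u v, a ≠ b → IsLeafAt G a u → IsLeafAt G b v → c s(a, u) = σ → c s(b, v) = σ →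
      s(a, b) ∈ E → ∃ w ∈ supportVertices G, w ≠ a ∧ w ≠ b ∧
        cliqueTreeColoring G (supportVertices G) T c E g σ τ ρ s(a, w) ≠
          cliqueTreeColoring G (supportVertices G) T c E g σ τ ρ s(w, b)) :
    IsCFConnectionColoring G (cliqueTreeColoring G (supportVertices G) T c E g σ τ ρ) := by
  have hAcut := fun {a b} (ha : a ∈ supportVertices G) (hb : b ∈ supportVertices G) =>
    not_mem_cutEdges_of_supportVertices hconn hdiam hpend ha hb
  refine isCFConnectionColoring_of_isCliqueTree (σ := σ) hconn hdiam hpend hT ?_ ?_ ?_ hlink ?_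
  · intro a b b' h h' hne
    rw [cliqueTreeColoring_cut h, cliqueTreeColoring_cut h']
    exact hc a b b' h h' hne
  · intro x y _ hcut hmem
    exact cliqueTreeColoring_outside_iff hρ (fun e he x hx => (hE e he x hx).1) hg hcut hmem
  · intro a ha _ h
    rw [cliqueTreeColoring_inside_iff hτ hρ (hAcut hT.center_mem ha) hT.center_mem ha] at h
    exact (hE _ h o (Sym2.mem_mk_left _ _)).2 rfl
  · intro a b u v hab hu hv hua hvb hσ
    rw [cliqueTreeColoring_cut hu.mem_cutEdges] at hua
    rw [cliqueTreeColoring_cut hv.mem_cutEdges] at hvb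
    have ha : a ∈ supportVertices G := ⟨u, hu⟩
    have hb : b ∈ supportVertices G := ⟨v, hv⟩
    rw [cliqueTreeColoring_inside_iff hτ hρ (hAcut ha hb) ha hb] at hσ
    exact hcol a b u v hab hu hv hua hvb hσ

/-- The triangle is a maximal nonseparable set: by `hcross` a branch can only be left through its
root, so a vertex `w` outside `A` is cut off from the other vertices of `A` by deleting `r w`. -/
lemma isExceptional_of_isCliqueTree [Finite V] (hconn : G.Connected) (hdiam : G.diam = 3)
    (hpend : CutEdgesPendant G) {o : V} {T : SimpleGraph V} {r : V → V}
    (hT : IsCliqueTree G (supportVertices G) o T r)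
    (hcross : ∀ x y, G.Adj x y → r x ≠ r y → x ∈ supportVertices G ∧ y ∈ supportVertices G)
    {q : Fin 3 → Fin 3 → V} (hp : Function.Injective fun i => q i 0)
    (hrange : ∀ i, q i 0 ∈ supportVertices G)
    (hleaf : ∀ i j, j ≠ 0 → IsLeafAt G (q i 0) (q i j)) (hq : ∀ i, q i 1 ≠ q i 2)
    (hall : ∀ a y, IsLeafAt G a y → ∃ i j, j ≠ 0 ∧ a = q i 0 ∧ y = q i j) : IsExceptional G := by
  set A := supportVertices G with hA
  have hAadj := fun {a b} (ha : a ∈ A) (hb : b ∈ A) (hab : a ≠ b) =>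
    adj_of_mem_supportVertices hconn hdiam ha hb hab
  have hleafA : ∀ i j, j ≠ 0 → q i j ∉ A := fun i j hj =>
    not_mem_supportVertices hconn hdiam (hleaf i j hj)
  have hinj : Function.Injective fun x : Fin 3 × Fin 3 => q x.1 x.2 := by
    rintro ⟨i, j⟩ ⟨i', j'⟩ h
    simp only at h
    by_cases hj : j = 0 <;> by_cases hj' : j' = 0
    · subst hj hj'; rw [hp h]
    · subst hj; exact absurd (h ▸ hrange i) (hleafA i' j' hj')
    · subst hj'; exact absurd (h ▸ hrange i') (hleafA i j hj)
    · have hi : i' = i :=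
        hp ((hleaf i j hj).2 _ (h ▸ (hleaf i' j' hj').1.symm))
      subst hi
      have h12 : ∀ j : Fin 3, j ≠ 0 → j = 1 ∨ j = 2 := by decide
      rcases h12 j hj with rfl | rfl <;> rcases h12 j' hj' with rfl | rfl
      · rfl
      · exact absurd h (hq i')
      · exact absurd h.symm (hq i')
      · rfl
  have hmap : ∀ x y : Fin 3 × Fin 3,
      G.Adj (q x.1 x.2) (q y.1 y.2) ↔ triangleWithStars.Adj x y := by
    rintro ⟨i, j⟩ ⟨i', j'⟩
    have key : ∀ i i' j', j' ≠ 0 → (G.Adj (q i 0) (q i' j') ↔ i = i') := by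
      intro i i' j' hj'
      constructor
      · exact fun h => hp ((hleaf i' j' hj').2 _ h.symm)
      · rintro rfl
        exact (hleaf i j' hj').1
    simp only [triangleWithStars]
    by_cases hj : j = 0 <;> by_cases hj' : j' = 0
    · subst hj hj'
      constructor
      · intro h
        refine ⟨?_, Or.inl ⟨rfl, rfl⟩⟩
        rintro h'
        rw [Prod.mk.injEq] at h'
        exact h.ne (by rw [h'.1])
      · rintro ⟨h, -⟩
        exact hAadj (hrange i) (hrange i') fun h' => h (by rw [hp h'])
    · subst hj
      rw [key i i' j' hj']
      simp [hj', Ne.symm hj']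
    · subst hj'
      rw [G.adj_comm, key i' i j hj]
      simp [hj, eq_comm]
    · constructor
      · intro h
        exact absurd ((hleaf i' j' hj').2 _ h.symm ▸ hrange i') (hleafA i j hj)
      · simp [hj, hj']
  have hAeq : ∀ a, a ∈ A ↔ ∃ i, q i 0 = a := by
    intro a
    constructor
    · rintro ⟨y, hy⟩
      obtain ⟨i, j, -, h, -⟩ := hall a y hy
      exact ⟨i, h.symm⟩
    · rintro ⟨i, rfl⟩
      exact hrange i
  let φ : triangleWithStars ↪g G := ⟨⟨_, hinj⟩, hmap _ _⟩
  have hset : Set.range (fun i : Fin 3 => φ (i, 0)) = A := by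
    ext a
    exact (hAeq a).symm
  refine ⟨φ, ?_, ?_⟩
  · rw [hset]
    refine ⟨⟨(connected_iff _).2 ⟨?_, ⟨⟨_, hrange 0⟩⟩⟩, ?_⟩, ?_⟩
    · intro x y
      by_cases hxy : x = y
      · rw [hxy]
      · exact Adj.reachable (hAadj x.2 y.2 fun h => hxy (Subtype.ext h))
    · intro v x y
      by_cases hxy : x = y
      · rw [hxy]
      · exact Adj.reachable (hAadj x.1.2 y.1.2 fun h => hxy (Subtype.ext (Subtype.ext h)))
    · intro S hS hns
      refine Set.Subset.antisymm (fun w hw => ?_) hS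
      by_contra hwA
      have hrw := hT.root_mem w
      obtain ⟨b, hb, hbr⟩ : ∃ b ∈ A, b ≠ r w := by
        by_cases h : q 0 0 = r w
        · exact ⟨q 1 0, hrange 1, fun h' => absurd (hp (h.trans h'.symm)) (by decide)⟩
        · exact ⟨_, hrange 0, h⟩
      let a' : S := ⟨r w, hS hrw⟩
      have hinv : ∀ s t, ∀ p : ((G.induce S).induce {a'}ᶜ).Walk s t,
          r s.1.1 = r w → r t.1.1 = r w := by
        intro s t p
        induction p with
        | nil => exact id
        | @cons s s' t g p ih =>
          intro hs
          refine ih ?_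
          by_contra hs'
          have hsA := (hcross s.1.1 s'.1.1 g fun h => hs' (h.symm.trans hs)).1
          refine s.2 (Subtype.ext ?_)
          exact (hT.root_self _ hsA).symm.trans hs
      obtain ⟨p⟩ := hns.2 a' ⟨⟨w, hw⟩, fun h => hwA (by
        have : w = r w := congrArg Subtype.val h
        exact this ▸ hrw)⟩ ⟨⟨b, hS hb⟩, fun h => hbr (congrArg Subtype.val h)⟩
      have := hinv _ _ p rfl
      exact hbr ((hT.root_self b hb).symm.trans this)
  · ext e
    constructor
    · obtain ⟨x, y⟩ := e
      intro he
      rcases hpend x y he with h | h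
      · obtain ⟨i, j, hj, rfl, rfl⟩ := hall _ _ h
        exact ⟨i, j, hj, rfl⟩
      · obtain ⟨i, j, hj, rfl, rfl⟩ := hall _ _ h
        exact ⟨i, j, hj, Sym2.eq_swap⟩
    · rintro ⟨i, j, hj, rfl⟩
      exact (hleaf i j hj).mem_cutEdges

/-! ### The upper bound -/

lemma exists_mem_ne_ne {A : Set V} {p q s : V} (hp : p ∈ A) (hq : q ∈ A) (hs : s ∈ A)
    (hpq : p ≠ q) (hsp : s ≠ p) (hsq : s ≠ q) (x y : V) : ∃ z ∈ A, z ≠ x ∧ z ≠ y := by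
  grind

/-- Outside the exceptional case, a proper colouring of the cut-edges yields a conflict-free
connection colouring with the same number of colours. -/
lemma exists_cfColoring_of_cutQuadruple [Finite V] (hconn : G.Connected) (hdiam : G.diam = 3)
    {k : ℕ} (hk : 2 ≤ k) {c : Sym2 V → Fin k} (hc : ProperOnCuts G c) {u₀ a₀ b₀ v₀ : V}
    (h₀ : CutQuadruple G u₀ a₀ b₀ v₀) :
    (∃ c : Sym2 V → Fin k, IsCFConnectionColoring G c) ∨ k = 2 ∧ IsExceptional G := by
  have hpend : CutEdgesPendant G := fun x y => h₀.isLeafAt_or hconn hdiam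
  set A := supportVertices G with hA
  have hAadj : ∀ a ∈ A, ∀ b ∈ A, a ≠ b → G.Adj a b := fun a ha b hb hab =>
    adj_of_mem_supportVertices hconn hdiam ha hb hab
  have hAcut : ∀ a ∈ A, ∀ b ∈ A, s(a, b) ∉ cutEdges G := fun a ha b hb =>
    not_mem_cutEdges_of_supportVertices hconn hdiam hpend ha hb
  have ha₀ : a₀ ∈ A := ⟨u₀, h₀.isLeafAt_left hpend⟩
  have hb₀ : b₀ ∈ A := ⟨v₀, h₀.symm.isLeafAt_left hpend⟩
  have hab₀ := h₀.adj.ne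
  have hother : ∀ σ : Fin k, ∃ ρ, ρ ≠ σ := fun σ =>
    have : Nontrivial (Fin k) := Fin.nontrivial_iff_two_le.2 hk
    exists_ne σ
  -- an edge between different branches, not inside the clique
  have hcrossing : ∀ {o T r}, IsCliqueTree G A o T r →
      (∃ x y, G.Adj x y ∧ r x ≠ r y ∧ ¬ (x ∈ A ∧ y ∈ A)) →
      ∃ c : Sym2 V → Fin k, IsCFConnectionColoring G c := by
    rintro o T r hT ⟨x, y, hxy, hr, hmem⟩
    obtain ⟨ρ, hρ⟩ := hother ⟨0, by omega⟩
    have hxT : ¬ T.Adj x y := fun h => hr (hT.root_eq x y ⟨h, hmem⟩)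
    have hxc : s(x, y) ∉ cutEdges G := fun h =>
      hxT (cutEdges_subset_of_connected hT.isTree.connected hT.le h)
    -- Here `σ` is not needed inside `A`: the edge `s(x, y)` does all the linking. The loop `s(o,
    -- o)` is a dummy value for `g`.
    refine ⟨_, hT.isCFConnectionColoring hconn hdiam hpend (E := ∅) (g := s(o, o)) hρ hρ hc
      (by simp) ?_ ?_ (by simp)⟩
    · simpa using hT.center_mem
    · intro a ha b hb hab
      refine linked_of_crossing_edge hxy hxc ?_ hT.root_mem hr ?_ ha hb hab
      · rw [cliqueTreeColoring_outside_iff hρ (by simp) (by simpa using hT.center_mem) hxc hmem]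
        exact hxT
      · intro p hp q hq _ _
        rw [Ne, cliqueTreeColoring_inside_iff hρ hρ (hAcut p hp q hq) hp hq]
        exact Set.notMem_empty _
  -- otherwise the clique has at least three vertices
  have hthree : ∀ {o T r}, IsCliqueTree G A o T r →
      (∀ x y, G.Adj x y → r x ≠ r y → x ∈ A ∧ y ∈ A) → ∃ d ∈ A, d ≠ a₀ ∧ d ≠ b₀ := by
    intro o T r hT hcross
    have hreach : (G.deleteEdges {s(a₀, b₀)}).Reachable a₀ b₀ := by
      by_contra h
      exact h₀.not_cut ⟨h₀.adj, h⟩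
    by_contra! hn
    -- If `A` were `{a₀, b₀}`, only the deleted edge could change the root, although it is not a
    -- bridge.
    have hinv : ∀ s t, ∀ w : (G.deleteEdges {s(a₀, b₀)}).Walk s t, r s = r t := by
      intro s t w
      induction w with
      | nil => rfl
      | @cons s s' t g w ih =>
        rw [← ih]
        by_contra hne
        rw [deleteEdges_adj] at g
        obtain ⟨hs, hs'⟩ := hcross s s' g.1 hne
        refine g.2 ?_
        rw [Set.mem_singleton_iff, Sym2.eq_iff]
        by_cases h1 : s = a₀
        · exact Or.inl ⟨h1, hn s' hs' fun h => g.1.ne (h1.trans h.symm)⟩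
        · refine Or.inr ⟨hn s hs h1, ?_⟩
          by_contra h2
          exact g.1.ne ((hn s hs h1).trans (hn s' hs' h2).symm)
    obtain ⟨w⟩ := hreach
    have := hinv _ _ w
    rw [hT.root_self _ ha₀, hT.root_self _ hb₀] at this
    exact hab₀ this
  -- one edge of the clique receives the special colour
  have hone : ∀ {o T r}, IsCliqueTree G A o T r → ∀ {σ τ ρ : Fin k}, τ ≠ σ → ρ ≠ σ →
      ∀ {a₁ a₂ : V}, a₁ ∈ A → a₂ ∈ A → a₁ ≠ a₂ → a₁ ≠ o → a₂ ≠ o →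
      ∀ g : Sym2 V, (∀ x ∈ g, x ∈ A) →
      ((∀ y, IsLeafAt G a₁ y → c s(a₁, y) ≠ σ) ∨ τ ≠ ρ ∧ g = s(a₂, o)) →
      ∃ c : Sym2 V → Fin k, IsCFConnectionColoring G c := by
    intro o T r hT σ τ ρ hτ hρ a₁ a₂ h₁ h₂ h₁₂ h₁o h₂o g hg hcase
    refine ⟨_, hT.isCFConnectionColoring hconn hdiam hpend (E := {s(a₁, a₂)}) (g := g) hτ hρ hc
      ?_ hg ?_ ?_⟩
    · rintro e rfl x hx
      rcases Sym2.mem_iff.1 hx with rfl | rfl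
      · exact ⟨h₁, h₁o⟩
      · exact ⟨h₂, h₂o⟩
    · intro a ha b hb hab
      refine linked_of_crossing_edge (hAadj _ h₁ _ h₂ h₁₂) (hAcut _ h₁ _ h₂) ?_ hT.root_mem
        (by rwa [hT.root_self _ h₁, hT.root_self _ h₂]) ?_ ha hb hab
      · rw [cliqueTreeColoring_inside_iff hτ hρ (hAcut _ h₁ _ h₂) h₁ h₂]
        rfl
      · intro p hp q hq _ hne
        rw [Ne, cliqueTreeColoring_inside_iff hτ hρ (hAcut p hp q hq) hp hq]
        rwa [hT.root_self _ h₁, hT.root_self _ h₂] at hne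
    · intro a b u v hab hu hv hua hvb hE
      rw [Set.mem_singleton_iff, Sym2.eq_iff] at hE
      rcases hcase with hmiss | ⟨hτρ, rfl⟩
      · rcases hE with ⟨rfl, rfl⟩ | ⟨rfl, rfl⟩
        · exact absurd hua (hmiss _ hu)
        · exact absurd hvb (hmiss _ hv)
      · have e1 : cliqueTreeColoring G A T c {s(a₁, a₂)} s(a₂, o) σ τ ρ s(a₁, o) = ρ := by
          rw [cliqueTreeColoring_inside (hAcut _ h₁ _ hT.center_mem) h₁ hT.center_mem, if_neg]
          · rwa [Sym2.congr_left]
          · rw [Set.mem_singleton_iff, Sym2.congr_right]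
            exact h₂o.symm
        have e2 : cliqueTreeColoring G A T c {s(a₁, a₂)} s(a₂, o) σ τ ρ s(a₂, o) = τ := by
          rw [cliqueTreeColoring_inside (hAcut _ h₂ _ hT.center_mem) h₂ hT.center_mem, if_pos rfl]
          rw [Set.mem_singleton_iff, Sym2.eq_swap, Sym2.congr_left]
          exact h₁o.symm
        -- The detour through `o` uses one edge coloured `ρ` and one coloured `τ`.
        refine ⟨o, hT.center_mem, ?_⟩
        rcases hE with ⟨rfl, rfl⟩ | ⟨rfl, rfl⟩
        · refine ⟨h₁o.symm, h₂o.symm, ?_⟩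
          rw [Sym2.eq_swap (a := o), e1, e2]
          exact hτρ.symm
        · refine ⟨h₂o.symm, h₁o.symm, ?_⟩
          rw [Sym2.eq_swap (a := o), e1, e2]
          exact hτρ
  by_cases hmiss : ∃ a₁ ∈ A, ∃ μ, ∀ y, IsLeafAt G a₁ y → c s(a₁, y) ≠ μ
  · left
    obtain ⟨a₁, h₁, σ, hσ⟩ := hmiss
    obtain ⟨o, ho, ho₁⟩ : ∃ o ∈ A, o ≠ a₁ := by
      by_cases h : a₀ = a₁
      · exact ⟨b₀, hb₀, fun h' => hab₀ (h.trans h'.symm)⟩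
      · exact ⟨a₀, ha₀, h⟩
    obtain ⟨T, r, hT⟩ := exists_isCliqueTree hconn ho hAadj
    by_cases hcr : ∃ x y, G.Adj x y ∧ r x ≠ r y ∧ ¬ (x ∈ A ∧ y ∈ A)
    · exact hcrossing hT hcr
    have hcross : ∀ x y, G.Adj x y → r x ≠ r y → x ∈ A ∧ y ∈ A := fun x y h1 h2 => by
      by_contra h3
      exact hcr ⟨x, y, h1, h2, h3⟩
    obtain ⟨d, hd, hda, hdb⟩ := hthree hT hcross
    obtain ⟨a₂, h₂, h₂₁, h₂o⟩ : ∃ a₂ ∈ A, a₂ ≠ a₁ ∧ a₂ ≠ o := by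
      exact exists_mem_ne_ne ha₀ hb₀ hd hab₀ hda hdb a₁ o
    obtain ⟨ρ, hρ⟩ := hother σ
    -- No pendant edge at `a₁` has the colour `σ`, so a quadruple over `s(a₁, a₂)` never has both
    -- end edges coloured `σ`.
    exact hone hT hρ hρ h₁ h₂ h₂₁.symm ho₁.symm h₂o s(o, o) (by simpa using ho) (Or.inl hσ)
  · push Not at hmiss
    obtain ⟨T, r, hT⟩ := exists_isCliqueTree hconn ha₀ hAadj
    by_cases hcr : ∃ x y, G.Adj x y ∧ r x ≠ r y ∧ ¬ (x ∈ A ∧ y ∈ A)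
    · exact Or.inl (hcrossing hT hcr)
    have hcross : ∀ x y, G.Adj x y → r x ≠ r y → x ∈ A ∧ y ∈ A := fun x y h1 h2 => by
      by_contra h3
      exact hcr ⟨x, y, h1, h2, h3⟩
    obtain ⟨d, hd, hda, hdb⟩ := hthree hT hcross
    let σ : Fin k := ⟨0, by omega⟩
    obtain ⟨ρ, hρ⟩ := hother σ
    by_cases h4 : ∃ v ∈ A, v ≠ a₀ ∧ v ≠ b₀ ∧ v ≠ d
    · left
      obtain ⟨v, hv, hva, hvb, hvd⟩ := h4
      have hσ : ∀ a ∈ A, ∀ b ∈ A, a ≠ b → (cliqueTreeColoring G A T c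
          {s(b₀, d), s(d, v)} s(a₀, a₀) σ ρ ρ s(a, b) = σ ↔ s(a, b) = s(b₀, d) ∨
            s(a, b) = s(d, v)) := by
        intro a ha b hb _
        rw [cliqueTreeColoring_inside_iff hρ hρ (hAcut a ha b hb) ha hb]
        rfl
      -- In the triangle `b₀, d, v` exactly two edges have colour `σ`. The detour around either of
      -- them uses the other one and the edge `s(b₀, v)`, which is not coloured `σ`.
      refine ⟨_, hT.isCFConnectionColoring hconn hdiam hpend (E := {s(b₀, d), s(d, v)})
        (g := s(a₀, a₀)) hρ hρ hc ?_ (by simpa using ha₀) ?_ ?_⟩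
      · rintro e (rfl | rfl) x hx <;> rcases Sym2.mem_iff.1 hx with rfl | rfl
        exacts [⟨hb₀, hab₀.symm⟩, ⟨hd, hda⟩, ⟨hd, hda⟩, ⟨hv, hva⟩]
      · intro a ha b hb hab
        exact linked_of_two_edges hAadj hAcut hT.root_self hb₀ hd hv ha₀ hdb.symm hvd.symm hvb.symm
          hab₀ hda.symm hva.symm hσ ha hb hab
      · have e1 := (hσ b₀ hb₀ d hd hdb.symm).2 (Or.inl rfl)
        have e2 := (hσ d hd v hv hvd.symm).2 (Or.inr rfl)
        have e3 : cliqueTreeColoring G A T c {s(b₀, d), s(d, v)} s(a₀, a₀) σ ρ ρ s(b₀, v) ≠ σ := by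
          rw [Ne, hσ b₀ hb₀ v hv hvb.symm, Sym2.congr_right, Sym2.congr_left]
          exact not_or.2 ⟨hvd, hdb.symm⟩
        have e1' := (congrArg (cliqueTreeColoring G A T c {s(b₀, d), s(d, v)} s(a₀, a₀) σ ρ ρ)
          (Sym2.eq_swap (a := d) (b := b₀))).trans e1
        have e2' := (congrArg (cliqueTreeColoring G A T c {s(b₀, d), s(d, v)} s(a₀, a₀) σ ρ ρ)
          (Sym2.eq_swap (a := v) (b := d))).trans e2
        have e3' := fun h => e3 ((congrArg (cliqueTreeColoring G A T c {s(b₀, d), s(d, v)}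
          s(a₀, a₀) σ ρ ρ) (Sym2.eq_swap (a := b₀) (b := v))).trans h)
        intro a b u w _ _ _ _ _ hE
        rcases hE with hE | hE
        · rw [Sym2.eq_iff] at hE
          rcases hE with ⟨rfl, rfl⟩ | ⟨rfl, rfl⟩
          · exact ⟨v, hv, hvb, hvd, fun h => e3 (h.trans e2')⟩
          · exact ⟨v, hv, hvd, hvb, fun h => e3' (h.symm.trans e2)⟩
        · rw [Set.mem_singleton_iff, Sym2.eq_iff] at hE
          rcases hE with ⟨rfl, rfl⟩ | ⟨rfl, rfl⟩
          · exact ⟨b₀, hb₀, hdb.symm, hvb.symm, fun h => e3 (h.symm.trans e1')⟩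
          · exact ⟨b₀, hb₀, hvb.symm, hdb.symm, fun h => e3' (h.trans e1)⟩
    push Not at h4
    by_cases hτ : ∃ τ, τ ≠ σ ∧ τ ≠ ρ
    · obtain ⟨τ, hτσ, hτρ⟩ := hτ
      -- With a third colour the three edges of the triangle `a₀, b₀, d` get three different
      -- colours.
      refine Or.inl (hone hT hτσ hρ hb₀ hd hdb.symm hab₀.symm hda s(d, a₀) ?_ (Or.inr ⟨hτρ, rfl⟩))
      intro x hx
      rcases Sym2.mem_iff.1 hx with rfl | rfl <;> assumption
    push Not at hτ
    right
    have hk2 : k = 2 := by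
      by_contra hne
      have h1 := hτ ⟨1, by omega⟩ (by simp [σ])
      have h2 := hτ ⟨2, by omega⟩ (by simp [σ])
      exact absurd (h1.trans h2.symm) (by simp)
    refine ⟨hk2, ?_⟩
    have hleaf : ∀ a, a ∈ A → ∀ μ, ∃ y, IsLeafAt G a y ∧ c s(a, y) = μ := fun a ha => hmiss a ha
    have hpA : ∀ i : Fin 3, ![a₀, b₀, d] i ∈ A := by
      intro i
      fin_cases i <;> assumption
    choose y hy using fun i => hleaf _ (hpA i)
    have huniq : ∀ i z μ, IsLeafAt G (![a₀, b₀, d] i) z → c s(![a₀, b₀, d] i, z) = μ →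
        z = y i μ := by
      intro i z μ hz hzμ
      by_contra hne
      exact hc _ _ _ hz.mem_cutEdges (hy i μ).1.mem_cutEdges hne (hzμ.trans (hy i μ).2.symm)
    refine isExceptional_of_isCliqueTree (q := fun i => ![![a₀, b₀, d] i, y i σ, y i ρ])
      hconn hdiam hpend hT hcross ?_ ?_ ?_ ?_ ?_
    · intro i j
      fin_cases i <;> fin_cases j <;> simp [hab₀, hab₀.symm, hda, hdb, hda.symm, hdb.symm]
    · exact hpA
    · intro i j hj
      fin_cases j
      · exact absurd rfl hj
      · exact (hy i σ).1
      · exact (hy i ρ).1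
    · intro i h
      have h' : y i σ = y i ρ := h
      exact hρ ((hy i ρ).2.symm.trans ((congrArg (fun z => c s(_, z)) h'.symm).trans (hy i σ).2))
    · intro a z hz
      obtain ⟨i, rfl⟩ : ∃ i, a = ![a₀, b₀, d] i := by
        have ha : a ∈ A := ⟨z, hz⟩
        by_cases h1 : a = a₀
        · exact ⟨0, h1⟩
        by_cases h2 : a = b₀
        · exact ⟨1, h2⟩
        · exact ⟨2, h4 a ha h1 h2⟩
      by_cases hcol : c s(![a₀, b₀, d] i, z) = σ
      · exact ⟨i, 1, by decide, rfl, huniq i z σ hz hcol⟩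
      · exact ⟨i, 2, by decide, rfl, huniq i z ρ hz (hτ _ hcol)⟩

lemma exists_cfColoring [Finite V] (hconn : G.Connected) (hdiam : G.diam = 3) {k : ℕ} (hk : 2 ≤ k)
    (hh : h G ≤ k) :
    (∃ c : Sym2 V → Fin k, IsCFConnectionColoring G c) ∨ k = 2 ∧ IsExceptional G := by
  obtain ⟨c, hc⟩ := exists_properOnCuts_of_h_le hh (by omega)
  by_cases hq : ∃ u a b v, CutQuadruple G u a b v
  · obtain ⟨u, a, b, v, hq⟩ := hq
    exact exists_cfColoring_of_cutQuadruple hconn hdiam hk hc hq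
  · push Not at hq
    have : Nontrivial (Fin k) := Fin.nontrivial_iff_two_le.2 hk
    obtain ⟨ρ, hρ⟩ := exists_ne (⟨0, by omega⟩ : Fin k)
    exact Or.inl (exists_cfColoring_of_no_cutQuadruple hconn hdiam hρ hc hq)

/-! ### The exceptional graphs -/

/-- A path between two vertices of a complete block stays inside the block. -/
lemma ConflictFree.IsBlock.support_subset {S : Set V} (hS : IsBlock G S)
    (hadj : ∀ x ∈ S, ∀ y ∈ S, x ≠ y → G.Adj x y) {a b : V} (ha : a ∈ S) (hb : b ∈ S)
    {p : G.Walk a b} (hp : p.IsPath) : ∀ x ∈ p.support, x ∈ S := by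
  classical
  set U : Set V := {x | x ∈ S ∨ x ∈ p.support} with hU
  have hpU : ∀ x ∈ p.support, x ∈ U := fun x hx => Or.inr hx
  have hSU : S ⊆ U := fun x hx => Or.inl hx
  suffices Nonseparable (G.induce U) by
    have hUS := hS.2 U hSU this
    intro x hx
    rw [← hUS]
    exact hpU x hx
  -- A deleted vertex `w` lies on at most one of the two parts into which `z` divides the path, so
  -- the other part leads from `z` to the clique `S`.
  have hkey : ∀ z ∈ U, ∀ w, z ≠ w → ∃ s ∈ S, s ≠ w ∧ ∃ q : G.Walk z s,
      (∀ x ∈ q.support, x ∈ U) ∧ w ∉ q.support := by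
    rintro z (hz | hz) w hzw
    · exact ⟨z, hz, hzw, Walk.nil, by simpa using hSU hz, by simpa using hzw.symm⟩
    · by_cases hw : w ∈ (p.takeUntil z hz).support
      · have hw' : w ∉ (p.dropUntil z hz).support := fun hw' => by
          have hpath : ((p.takeUntil z hz).append (p.dropUntil z hz)).IsPath := by
            rwa [p.take_spec hz]
          exact hzw (eq_of_mem_support_append hpath hw hw').symm
        refine ⟨b, hb, ?_, p.dropUntil z hz,
          fun x hx => hpU x (p.support_dropUntil_subset_support hz hx), hw'⟩
        rintro rfl
        exact hw' (Walk.end_mem_support _)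
      · refine ⟨a, ha, ?_, (p.takeUntil z hz).reverse, ?_, by simpa using hw⟩
        · rintro rfl
          exact hw (Walk.start_mem_support _)
        · intro x hx
          rw [Walk.support_reverse, List.mem_reverse] at hx
          exact hpU x (p.support_takeUntil_subset_support hz hx)
  have hjoin : ∀ z ∈ U, ∀ z' ∈ U, ∀ w, z ≠ w → z' ≠ w → ∃ q : G.Walk z z',
      (∀ x ∈ q.support, x ∈ U) ∧ w ∉ q.support := by
    intro z hz z' hz' w hzw hzw'
    obtain ⟨s, hs, hsw, q, hq, hqw⟩ := hkey z hz w hzw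
    obtain ⟨s', hs', hsw', q', hq', hqw'⟩ := hkey z' hz' w hzw'
    by_cases hss : s = s'
    · subst hss
      refine ⟨q.append q'.reverse, ?_, ?_⟩
      · intro x hx
        rw [Walk.mem_support_append_iff, Walk.support_reverse, List.mem_reverse] at hx
        exact hx.elim (hq x) (hq' x)
      · rw [Walk.mem_support_append_iff, Walk.support_reverse, List.mem_reverse]
        exact not_or.2 ⟨hqw, hqw'⟩
    · refine ⟨q.append (Walk.cons (hadj s hs s' hs' hss) q'.reverse), ?_, ?_⟩
      · intro x hx
        rw [Walk.mem_support_append_iff, Walk.support_cons, List.mem_cons, Walk.support_reverse,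
          List.mem_reverse] at hx
        rcases hx with hx | rfl | hx
        exacts [hq x hx, hSU hs, hq' x hx]
      · rw [Walk.mem_support_append_iff, Walk.support_cons, List.mem_cons, Walk.support_reverse,
          List.mem_reverse]
        exact not_or.2 ⟨hqw, not_or.2 ⟨hsw.symm, hqw'⟩⟩
  refine ⟨(connected_iff _).2 ⟨?_, ⟨⟨a, hSU ha⟩⟩⟩, ?_⟩
  · have hreach : ∀ z : U, (G.induce U).Reachable ⟨a, hSU ha⟩ z := by
      rintro ⟨z, hz | hz⟩
      · by_cases haz : a = z
        · subst haz; exact .rfl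
        · exact Adj.reachable (hadj a ha z hz haz)
      · exact ⟨(p.takeUntil z hz).induce U
          fun x hx => hpU x (p.support_takeUntil_subset_support hz hx)⟩
    exact fun x y => (hreach x).symm.trans (hreach y)
  · intro w x y
    obtain ⟨q, hq, hqw⟩ := hjoin x.1.1 x.1.2 y.1.1 y.1.2 w.1
      (fun h => x.2 (Subtype.ext h)) (fun h => y.2 (Subtype.ext h))
    refine ⟨(q.induce U hq).induce {w}ᶜ ?_⟩
    rintro s hs rfl
    rw [Walk.support_induce] at hs
    refine hqw ?_
    simpa using hs

lemma exists_middle_of_leaves {a b u v : V} (hu : IsLeafAt G a u) (hv : IsLeafAt G b v)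
    (huv : u ≠ v) (hav : a ≠ v) {p : G.Walk u v} (hp : p.IsPath) :
    ∃ m : G.Walk a b, m.IsPath ∧ p.edges = s(u, a) :: (m.edges ++ [s(b, v)]) := by
  cases p with
  | nil => exact absurd rfl huv
  | cons g p =>
    obtain rfl := hu.2 _ g
    rw [Walk.cons_isPath_iff] at hp
    have hr := hp.1.reverse
    have he : p.edges = p.reverse.edges.reverse := by simp
    rw [Walk.edges_cons, he]
    generalize p.reverse = p' at hr
    cases p' with
    | nil => exact absurd rfl hav
    | cons g' p' =>
      obtain rfl := hv.2 _ g'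
      rw [Walk.cons_isPath_iff] at hr
      refine ⟨p'.reverse, hr.1.reverse, ?_⟩
      simp [Sym2.eq_swap]

lemma edges_of_path_in_triangle {a b d : V} (hab : a ≠ b) {m : G.Walk a b} (hm : m.IsPath)
    (hS : ∀ x ∈ m.support, x = a ∨ x = b ∨ x = d) :
    m.edges = [s(a, b)] ∨ m.edges = [s(a, d), s(d, b)] := by
  cases m with
  | nil => exact absurd rfl hab
  | @cons _ x _ g m =>
  rw [Walk.cons_isPath_iff] at hm
  cases m with
  | nil => exact Or.inl rfl
  | @cons _ y _ g2 m =>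
  obtain ⟨hm, ha⟩ := hm
  rw [Walk.cons_isPath_iff] at hm
  have hxb : x ≠ b := by rintro rfl; exact hm.2 m.end_mem_support
  obtain rfl : x = d := by
    rcases hS x (by simp) with h | h | h
    exacts [absurd h.symm g.ne, absurd h hxb, h]
  cases m with
  | nil => exact Or.inr rfl
  | @cons _ z _ g3 m =>
  rw [Walk.cons_isPath_iff] at hm
  exfalso
  rcases hS y (by simp) with rfl | rfl | rfl
  · exact ha (by simp)
  · exact hm.1.2 m.end_mem_support
  · exact g2.ne rfl

section Exceptional

variable {φ : triangleWithStars ↪g G}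

lemma star_mem_cutEdges
    (hcut : cutEdges G = {e | ∃ i j : Fin 3, j ≠ 0 ∧ e = s(φ (i, 0), φ (i, j))}) (i : Fin 3)
    {j : Fin 3} (hj : j ≠ 0) : s(φ (i, 0), φ (i, j)) ∈ cutEdges G := by
  rw [hcut]
  exact ⟨i, j, hj, rfl⟩

lemma h_eq_two_of_isExceptional [Finite V] (hconn : G.Connected) (hdiam : G.diam = 3)
    (hcut : cutEdges G = {e | ∃ i j : Fin 3, j ≠ 0 ∧ e = s(φ (i, 0), φ (i, j))}) : h G = 2 := by
  classical
  apply le_antisymm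
  · let c : Sym2 V → Fin 2 := fun e => if ∃ i, φ (i, 1) ∈ e then 0 else 1
    have hcol : ∀ i j : Fin 3, j ≠ 0 → (c s(φ (i, 0), φ (i, j)) = 0 ↔ j = 1) := by
      intro i j hj
      have : (∃ i', φ (i', 1) ∈ s(φ (i, 0), φ (i, j))) ↔ j = 1 := by
        constructor
        · rintro ⟨i', hi'⟩
          rcases Sym2.mem_iff.1 hi' with h | h
          · exact absurd (Prod.ext_iff.1 (φ.injective h)).2 (by simp)
          · exact (Prod.ext_iff.1 (φ.injective h)).2.symm
        · rintro rfl
          exact ⟨i, Sym2.mem_mk_right _ _⟩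
      by_cases hj1 : j = 1
      · simp [c, hj1]
      · simp only [c, this, hj1, if_false]
        simp
    refine h_le_of_properOnCuts hconn hdiam (c := c) ?_
    intro a b b' h h' hne hc
    rw [hcut] at h h'
    obtain ⟨i, j, hj, e⟩ := h
    obtain ⟨i', j', hj', e'⟩ := h'
    have h1 := hcol i j hj
    have h2 := hcol i' j' hj'
    rw [← e, hc, e'] at h1
    have hjj : j = 1 ↔ j' = 1 := h1.symm.trans h2
    have h12 : ∀ j : Fin 3, j ≠ 0 → j = 1 ∨ j = 2 := by decide
    have hj_eq : j = j' := by
      rcases h12 j hj with rfl | rfl <;> rcases h12 j' hj' with rfl | rfl <;> simp_all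
    subst hj_eq
    rw [Sym2.eq_iff] at e e'
    rcases e with ⟨rfl, rfl⟩ | ⟨rfl, rfl⟩ <;> rcases e' with ⟨e1, rfl⟩ | ⟨e1, rfl⟩
    · have hi := (Prod.ext_iff.1 (φ.injective e1)).1
      simp only at hi
      exact hne (by rw [hi])
    · exact hj (Prod.ext_iff.1 (φ.injective e1)).2.symm
    · exact hj (Prod.ext_iff.1 (φ.injective e1)).2
    · have hi := (Prod.ext_iff.1 (φ.injective e1)).1
      simp only at hi
      exact hne (by rw [hi])
  · by_contra! hlt
    obtain ⟨c, hc⟩ := exists_properOnCuts_of_h_le (G := G) (k := 1) (by omega) (by omega)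
    refine hc (φ (0, 0)) (φ (0, 1)) (φ (0, 2)) (star_mem_cutEdges hcut 0 (by decide))
      (star_mem_cutEdges hcut 0 (by decide)) ?_ (Subsingleton.elim _ _)
    exact fun h => absurd (Prod.ext_iff.1 (φ.injective h)).2 (by decide)

/-- Properness puts both colours on the pendant edges at each triangle vertex, and the block
property confines the middle of every leaf-to-leaf path to the triangle. Any two triangle edges then
need different colours, but there are three edges and two colours. -/
lemma not_isCFConnectionColoring_two [Finite V] (hconn : G.Connected) (hdiam : G.diam = 3)
    (hblock : IsBlock G (Set.range fun i : Fin 3 => φ (i, 0)))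
    (hcut : cutEdges G = {e | ∃ i j : Fin 3, j ≠ 0 ∧ e = s(φ (i, 0), φ (i, j))})
    {c : Sym2 V → Fin 2} : ¬ IsCFConnectionColoring G c := by
  intro hc
  have hprop := properOnCuts_of_isCFConnectionColoring hc
  have hinj : ∀ {i j i' j' : Fin 3}, φ (i, j) = φ (i', j') → i = i' ∧ j = j' := fun h =>
    Prod.ext_iff.1 (φ.injective h)
  have htri : ∀ i i' : Fin 3, i ≠ i' → G.Adj (φ (i, 0)) (φ (i', 0)) := fun i i' h =>
    φ.map_adj_iff.2 ⟨fun h' => h (Prod.ext_iff.1 h').1, Or.inl ⟨rfl, rfl⟩⟩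
  have hquad : CutQuadruple G (φ (0, 1)) (φ (0, 0)) (φ (1, 0)) (φ (1, 1)) := by
    refine ⟨Sym2.eq_swap ▸ star_mem_cutEdges hcut 0 (by decide),
      star_mem_cutEdges hcut 1 (by decide), htri 0 1 (by decide), ?_, ?_⟩
    · rw [hcut]
      rintro ⟨i, j, hj, e⟩
      rw [Sym2.eq_iff] at e
      rcases e with ⟨-, e⟩ | ⟨e, -⟩
      · exact hj (hinj e).2.symm
      · exact hj (hinj e).2.symm
    · exact fun h => absurd (hinj h).1 (by decide)
  have hleaf : ∀ i j : Fin 3, j ≠ 0 → IsLeafAt G (φ (i, 0)) (φ (i, j)) := by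
    intro i j hj
    rcases hquad.isLeafAt_or hconn hdiam (star_mem_cutEdges hcut i hj) with h | h
    · exact h
    · exfalso
      obtain ⟨i', hi'⟩ := exists_ne i
      exact hj (hinj (h.2 _ (htri i i' hi'.symm))).2.symm
  have hcol : ∀ i μ, ∃ j : Fin 3, j ≠ 0 ∧ c s(φ (i, 0), φ (i, j)) = μ := by
    intro i μ
    have hne : c s(φ (i, 0), φ (i, 1)) ≠ c s(φ (i, 0), φ (i, 2)) :=
      hprop _ _ _ (star_mem_cutEdges hcut i (by decide)) (star_mem_cutEdges hcut i (by decide))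
        fun h => absurd (hinj h).2 (by decide)
    by_cases h1 : c s(φ (i, 0), φ (i, 1)) = μ
    · exact ⟨1, by decide, h1⟩
    · exact ⟨2, by decide, by omega⟩
  have key : ∀ i i' i'' : Fin 3, i ≠ i' → (∀ x, x = i ∨ x = i' ∨ x = i'') →
      c s(φ (i, 0), φ (i'', 0)) ≠ c s(φ (i'', 0), φ (i', 0)) := by
    intro i i' i'' hii hall heq
    -- Both leaves are chosen so that their pendant edges have the colour of the triangle edge
    -- between `i` and `i'`. The direct path is then monochromatic, and the detour through `i''` has
    -- each of its colours at least twice if its inner edges agree.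
    obtain ⟨j, hj, hjc⟩ := hcol i (c s(φ (i, 0), φ (i', 0)))
    obtain ⟨j', hj', hjc'⟩ := hcol i' (c s(φ (i, 0), φ (i', 0)))
    obtain ⟨p, hp, hu⟩ := hc (φ (i, j)) (φ (i', j')) fun h => hii (hinj h).1
    obtain ⟨m, hm, hpe⟩ := exists_middle_of_leaves (hleaf i j hj) (hleaf i' j' hj')
      (fun h => hii (hinj h).1) (fun h => hii (hinj h).1) hp
    have hmS := hblock.support_subset (by
      rintro _ ⟨s, rfl⟩ _ ⟨t, rfl⟩ hne
      exact htri s t fun h => hne (by rw [h])) ⟨i, rfl⟩ ⟨i', rfl⟩ hm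
    have hme := edges_of_path_in_triangle (d := φ (i'', 0)) (fun h => hii (hinj h).1) hm (by
      intro x hx
      obtain ⟨s, rfl⟩ := hmS x hx
      rcases hall s with rfl | rfl | rfl <;> simp)
    have hnd := hp.isTrail.edges_nodup
    rw [Sym2.eq_swap] at hjc
    rw [hpe] at hu hnd
    obtain ⟨e, he, hue⟩ := hu
    rcases hme with hme | hme <;> rw [hme] at he hue hnd <;>
      simp only [List.cons_append, List.nil_append, List.mem_cons, List.not_mem_nil, or_false,
        List.nodup_cons, not_or, forall_eq_or_imp, forall_eq] at he hue hnd
    · rcases he with rfl | rfl | rfl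
      · exact hnd.1.1 (hue.2.1 hjc.symm).symm
      · exact hnd.1.1 (hue.1 hjc)
      · exact hnd.1.2 (hue.1 (hjc.trans hjc'.symm))
    · rcases he with rfl | rfl | rfl | rfl
      · exact hnd.1.2.2 (hue.2.2.2 (hjc'.trans hjc.symm)).symm
      · exact hnd.2.1.1 (hue.2.2.1 heq.symm).symm
      · exact hnd.2.1.1 (hue.2.1 heq)
      · exact hnd.1.2.2 (hue.1 (hjc.trans hjc'.symm))
  have k1 := key 0 1 2 (by decide) (by decide)
  have k2 := key 0 2 1 (by decide) (by decide)
  have k3 := key 1 2 0 (by decide) (by decide)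
  rw [Sym2.eq_swap (a := φ (2, 0))] at k1
  rw [Sym2.eq_swap (a := φ (1, 0))] at k3
  omega

end Exceptional

end

/-! ### The main theorem -/

theorem mainTheorem5 {V : Type*} [Finite V] (G : SimpleGraph V)
    (hconn : G.Connected) (hdiam : G.diam = 3) :
    ConflictFree.vcfc G ≤ 3 ∧
    (¬ ConflictFree.IsExceptional G →
      ConflictFree.cfc G = max 2 (ConflictFree.h G)) ∧
    (ConflictFree.IsExceptional G →
      ConflictFree.cfc G = ConflictFree.h G + 1 ∧ ConflictFree.h G + 1 = 3) := by
  refine ⟨vcfc_le_three hconn hdiam, fun hex => ?_, ?_⟩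
  · refine le_antisymm ?_ (max_le (two_le_cfc hconn hdiam) (h_le_cfc hconn hdiam))
    rcases exists_cfColoring hconn hdiam (k := max 2 (ConflictFree.h G)) (le_max_left _ _)
      (le_max_right _ _) with ⟨c, hc⟩ | ⟨-, h⟩
    · exact cfc_le hc
    · exact absurd h hex
  · rintro ⟨φ, hblock, hcut⟩
    have h2 := h_eq_two_of_isExceptional hconn hdiam hcut
    refine ⟨?_, by omega⟩
    rw [h2]
    apply le_antisymm
    · rcases exists_cfColoring hconn hdiam (k := 3) (by omega) (by omega) with ⟨c, hc⟩ | ⟨h, -⟩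
      · exact cfc_le hc
      · omega
    · by_contra! hlt
      obtain ⟨c, hc⟩ := exists_cfColoring_of_cfc_le hconn (k := 2) (by omega)
      exact not_isCFConnectionColoring_two hconn hdiam hblock hcut hc
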